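/- Let $p$ be a prime and let $r,s\ge 1$ be integers. For $t\ge 1$ let ${\rm GR}(p^r,t)$ denote the Galois ring that is the Galois extension of $\mathbb{Z}/p^r\mathbb{Z}$ of degree $t$, with Teichm\"uller set $\mathcal{T}_t=\{x: x^{p^t}=x\}$. If $t$ is even, let $\overline{\alpha}=\sum_{i=0}^{r-1}\alpha_i^{p^{t/2}}p^i$ for $\alpha=\sum_{i=0}^{r-1}\alpha_i p^i\in{\rm GR}(p^r,t)$ with $\alpha_i\in\mathcal{T}_t$. For a finite abelian group $G$ (written additively), an abelian code in ${\rm GR}(p^r,t)[G]$ is an ideal $\mathcal{C}$ of this group ring. It is Euclidean self-dual if it equals its dual with respect to the form $\langle \sum_g\alpha_gY^g,\sum_g\beta_gY^g\rangle_{\rm E}=\sum_g\alpha_g\beta_g$, and, for $t$ even, Hermitian self-dual if it equals its dual with respect to $\langle \sum_g\alpha_gY^g,\sum_g\beta_gY^g\rangle_{\rm H}=\sum_g\alpha_g\overline{\beta_g}$. Let $NA$, $NEA$, $NHA$ of ${\rm GR}(p^r,t)[G]$ denote the numbers of all abelian codes, of Euclidean self-dual abelian codes, and (for $t$ even) of Hermitian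 self-dual abelian codes in ${\rm GR}(p^r,t)[G]$, respectively. For positive integers $j,q$ say that $(j,q)$ is oddly good if $j\mid q^t+1$ for some odd $t\ge1$, evenly good if $j\mid q^t+1$ for some even $t\ge 2$, and good if it is oddly or evenly good. Put $\chi(j,q)=0$ if $(j,q)$ is good and $\chi(j,q)=1$ otherwise; put $\lambda(j,q)=0$ if $(j,q)$ is oddly good and $\lambda(j,q)=1$ otherwise. Let ${\rm ord}_d(q)$ be the multiplicative order of $q$ modulo $d$, and let $\mathcal{N}_A(d)$ be the number of elements of order $d$ in a group $A$. Let $A$ be a finite abelian group of exponent $M$ with $p\nmid M$ (equivalently $p\nmid |A|$), and let $P$ be a finite abelian $p$-group. Then, all exponents being non-negative integers (more precisely, ${\rm ord}_d(p^s)\mid\mathcal{N}_A(d)$ and $2\,{\rm ord}_d(p^s)\mid\chi(d,p^s)\mathcal{N}_A(d)$ for every $d\mid M$), $$NEA({\rm GR}(p^r,s)[A\oplus P])=\left(NEA({\rm GR}(p^r,s)[P])\right)^{\sum_{d\mid M,\ {\rm ord}_d(p^s)=1}(1-\chi(d,p^s))\mathcal{N}_A(d)}\times\prod_{\substack{d\mid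 M\\ {\rm ord}_d(p^s)\neq1}}\left(NHA({\rm GR}(p^r,s\cdot{\rm ord}_d(p^s))[P])\right)^{(1-\chi(d,p^s))\frac{\mathcal{N}_A(d)}{{\rm ord}_d(p^s)}}\times\prod_{d\mid M}\left(NA({\rm GR}(p^r,s\cdot{\rm ord}_d(p^s))[P])\right)^{\chi(d,p^s)\frac{\mathcal{N}_A(d)}{2\,{\rm ord}_d(p^s)}}.$$ In addition, if $s$ is even, then (with $2\,{\rm ord}_d(p^s)\mid\lambda(d,p^{s/2})\mathcal{N}_A(d)$ for every $d\mid M$) $$NHA({\rm GR}(p^r,s)[A\oplus P])=\prod_{d\mid M}\left(NHA({\rm GR}(p^r,s\cdot{\rm ord}_d(p^s))[P])\right)^{(1-\lambda(d,p^{s/2}))\frac{\mathcal{N}_A(d)}{{\rm ord}_d(p^s)}}\times\prod_{d\mid M}\left(NA({\rm GR}(p^r,s\cdot{\rm ord}_d(p^s))[P])\right)^{\lambda(d,p^{s/2})\frac{\mathcal{N}_A(d)}{2\,{\rm ord}_d(p^s)}}.$$ Here a factor with exponent $0$ is understood to be $1$. -/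

import Mathlib

open Polynomial
open scoped AddMonoidAlgebra

/-! ### Galois rings -/

/-- For every `s` there is a monic integer polynomial of degree `s` which (for `s ≥ 1`) is
irreducible modulo `p`. -/
theorem exists_basicIrreducible (p : ℕ) [Fact p.Prime] (s : ℕ) :
    ∃ g : ℤ[X], g.Monic ∧ g.natDegree = s ∧
      (s ≠ 0 → Irreducible (g.map (Int.castRingHom (ZMod p)))) := by
  rcases eq_or_ne s 0 with rfl | hs
  · exact ⟨1, monic_one, natDegree_one, fun h => absurd rfl h⟩
  · obtain ⟨a, ha⟩ := Field.exists_primitive_element (ZMod p) (GaloisField p s)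
    have hint : IsIntegral (ZMod p) a := IsIntegral.of_finite _ _
    have hdeg : (minpoly (ZMod p) a).natDegree = s := by
      rw [← IntermediateField.adjoin.finrank hint, ha, IntermediateField.finrank_top',
        GaloisField.finrank p hs]
    have hl : minpoly (ZMod p) a ∈ lifts (Int.castRingHom (ZMod p)) :=
      map_surjective _ (ZMod.ringHom_surjective _) _
    obtain ⟨g, hg, hgd, hgm⟩ := lifts_and_natDegree_eq_and_monic hl (minpoly.monic hint)
    exact ⟨g, hgm, hgd.trans hdeg, fun _ => hg ▸ minpoly.irreducible hint⟩

/-- A monic integer polynomial of degree `s`, irreducible modulo `p` (if `s ≥ 1`). -/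
noncomputable def basicIrreducible (p : ℕ) [Fact p.Prime] (s : ℕ) : ℤ[X] :=
  (exists_basicIrreducible p s).choose

theorem basicIrreducible_monic (p : ℕ) [Fact p.Prime] (s : ℕ) : (basicIrreducible p s).Monic :=
  (exists_basicIrreducible p s).choose_spec.1

theorem basicIrreducible_natDegree (p : ℕ) [Fact p.Prime] (s : ℕ) :
    (basicIrreducible p s).natDegree = s :=
  (exists_basicIrreducible p s).choose_spec.2.1

theorem basicIrreducible_irreducible (p : ℕ) [Fact p.Prime] (s : ℕ) (hs : s ≠ 0) :
    Irreducible ((basicIrreducible p s).map (Int.castRingHom (ZMod p))) :=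
  (exists_basicIrreducible p s).choose_spec.2.2 hs

/-- The Galois ring `GR(p^r, s) = (ℤ/p^r)[X] / (f)`, the Galois extension of `ℤ/p^r` of degree `s`:
`f` is monic of degree `s` and irreducible modulo `p`. Up to isomorphism it does not depend on the
choice of `f`. -/
noncomputable abbrev GR (p : ℕ) [Fact p.Prime] (r s : ℕ) : Type :=
  AdjoinRoot ((basicIrreducible p s).map (Int.castRingHom (ZMod (p ^ r))))

/-- The Teichmüller set `{0, 1, ξ, …, ξ^(p^s - 2)}` of `GR(p^r, s)`, with `ξ` of order `p^s - 1`: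
it consists of the roots of `x^(p^s) = x`. -/
def teichmullerSet (p : ℕ) [Fact p.Prime] (r s : ℕ) : Set (GR p r s) :=
  {x | x ^ p ^ s = x}

theorem GR.natCast_pow_eq_zero (p : ℕ) [Fact p.Prime] (r s : ℕ) :
    (p : GR p r s) ^ r = 0 := by
  have h : ((p ^ r : ℕ) : ZMod (p ^ r)) = 0 := ZMod.natCast_self _
  have h2 := congrArg (AdjoinRoot.of ((basicIrreducible p s).map (Int.castRingHom (ZMod (p ^ r))))) h
  rw [map_natCast, map_zero, Nat.cast_pow] at h2
  exact h2

/-- The residue ring of `GR(p^r, s)` modulo `p` satisfies `x^(p^s) = x`. -/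
theorem GR.dvd_pow_sub_self (p : ℕ) [Fact p.Prime] (r s : ℕ) (hs : s ≠ 0) (x : GR p r s) :
    (p : GR p r s) ∣ x ^ p ^ s - x := by
  set g := basicIrreducible p s with hg
  set gb := g.map (Int.castRingHom (ZMod p)) with hgb
  have hirr : Irreducible gb := basicIrreducible_irreducible p s hs
  obtain ⟨h', rfl⟩ := AdjoinRoot.mk_surjective x
  obtain ⟨h, rfl⟩ := map_surjective (Int.castRingHom (ZMod (p ^ r))) (ZMod.ringHom_surjective _) h'
  have hmon : gb.Monic := (basicIrreducible_monic p s).map _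
  have hdeg : gb.natDegree = s := by
    rw [hgb, (basicIrreducible_monic p s).natDegree_map, basicIrreducible_natDegree]
  have : Fact (Irreducible gb) := ⟨hirr⟩
  have : Module.Finite (ZMod p) (AdjoinRoot gb) := hmon.finite_adjoinRoot
  have : Finite (AdjoinRoot gb) := Module.finite_of_finite (ZMod p)
  have : Fintype (AdjoinRoot gb) := Fintype.ofFinite _
  have hcard : Fintype.card (AdjoinRoot gb) = p ^ s := by
    rw [Module.card_eq_pow_finrank (K := ZMod p), ZMod.card,
      (AdjoinRoot.powerBasis' hmon).finrank, AdjoinRoot.powerBasis'_dim, hdeg]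
  have hz : AdjoinRoot.mk gb ((h ^ p ^ s - h).map (Int.castRingHom (ZMod p))) = 0 := by
    rw [Polynomial.map_sub, Polynomial.map_pow, map_sub, map_pow, ← hcard, FiniteField.pow_card,
      sub_self]
  obtain ⟨k', hk'⟩ := AdjoinRoot.mk_eq_zero.1 hz
  obtain ⟨k, rfl⟩ := map_surjective (Int.castRingHom (ZMod p)) (ZMod.ringHom_surjective _) k'
  have hd : (C (p : ℤ)) ∣ h ^ p ^ s - h - g * k := by
    rw [C_dvd_iff_dvd_coeff]
    intro i
    rw [← ZMod.intCast_zmod_eq_zero_iff_dvd]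
    have : (h ^ p ^ s - h - g * k).map (Int.castRingHom (ZMod p)) = 0 := by
      rw [Polynomial.map_sub, hk', Polynomial.map_mul, sub_self]
    have h2 := congrArg (fun q => q.coeff i) this
    simp only [coeff_map, coeff_zero] at h2
    exact h2
  obtain ⟨m, hm⟩ := hd
  let φ : ℤ[X] →+* GR p r s :=
    (AdjoinRoot.mk (g.map (Int.castRingHom (ZMod (p ^ r))))).comp
      (mapRingHom (Int.castRingHom (ZMod (p ^ r))))
  have h0 : φ g = 0 := AdjoinRoot.mk_self
  have hC : φ (C (p : ℤ)) = (p : GR p r s) := by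
    have : (C (p : ℤ) : ℤ[X]) = ((p : ℕ) : ℤ[X]) := by simp
    rw [this, map_natCast]
  have := congrArg φ hm
  rw [map_sub, map_sub, map_pow, map_mul, map_mul, h0, zero_mul, sub_zero, hC] at this
  exact ⟨φ m, this⟩

/-- Every residue class modulo `p` meets the Teichmüller set. -/
theorem GR.exists_teichmuller (p : ℕ) [Fact p.Prime] (r s : ℕ) (hs : s ≠ 0) (x : GR p r s) :
    ∃ t ∈ teichmullerSet p r s, (p : GR p r s) ∣ x - t := by
  refine ⟨x ^ p ^ (s * r), ?_, ?_⟩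
  · have h := dvd_sub_pow_of_dvd_sub (GR.dvd_pow_sub_self p r s hs x) (s * r)
    have hle : r ≤ s * r + 1 :=
      (Nat.le_mul_of_pos_left r (Nat.pos_of_ne_zero hs)).trans (Nat.le_succ _)
    have hz : (p : GR p r s) ^ (s * r + 1) = 0 := by
      rw [← Nat.add_sub_of_le hle, pow_add, GR.natCast_pow_eq_zero, zero_mul]
    rw [hz, zero_dvd_iff, sub_eq_zero] at h
    change (x ^ p ^ (s * r)) ^ p ^ s = x ^ p ^ (s * r)
    rw [← pow_mul, mul_comm, pow_mul, h]
  · suffices H : ∀ k : ℕ, (p : GR p r s) ∣ x - x ^ p ^ (s * k) from H r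
    intro k
    induction k with
    | zero => simp
    | succ k ih =>
      have h := GR.dvd_pow_sub_self p r s hs (x ^ p ^ (s * k))
      have h2 : x - x ^ p ^ (s * (k + 1)) =
          (x - x ^ p ^ (s * k)) - ((x ^ p ^ (s * k)) ^ p ^ s - x ^ p ^ (s * k)) := by
        rw [← pow_mul, ← pow_add, mul_add, mul_one]; ring
      rw [h2]
      exact dvd_sub ih h

/-- Every element of `GR(p^r, s)` has a `p`-adic expansion with Teichmüller digits. -/
theorem GR.exists_expansion (p : ℕ) [Fact p.Prime] (r s : ℕ) (x : GR p r s) :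
    ∃ c : Fin r → GR p r s, (∀ i, c i ∈ teichmullerSet p r s) ∧
      x = ∑ i, c i * (p : GR p r s) ^ (i : ℕ) := by
  rcases eq_or_ne s 0 with rfl | hs
  · have h1 : basicIrreducible p 0 = 1 :=
      eq_one_of_monic_natDegree_zero (basicIrreducible_monic p 0) (basicIrreducible_natDegree p 0)
    have : (1 : GR p r 0) = 0 := by
      have h := AdjoinRoot.mk_self (f := (basicIrreducible p 0).map (Int.castRingHom (ZMod (p ^ r))))
      conv_lhs at h => arg 2; rw [h1, Polynomial.map_one]
      rwa [map_one] at h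
    have : Subsingleton (GR p r 0) := subsingleton_of_zero_eq_one this.symm
    exact ⟨fun _ => 0, fun _ => Subsingleton.elim _ _, Subsingleton.elim _ _⟩
  · have key : ∀ (n : ℕ) (y : GR p r s), ∃ c : Fin n → GR p r s,
        (∀ i, c i ∈ teichmullerSet p r s) ∧
        ∃ z, y = ∑ i, c i * (p : GR p r s) ^ (i : ℕ) + (p : GR p r s) ^ n * z := by
      intro n
      induction n with
      | zero => exact fun y => ⟨Fin.elim0, fun i => i.elim0, y, by simp⟩
      | succ n ih =>
        intro y
        obtain ⟨t, ht, w, hw⟩ := GR.exists_teichmuller p r s hs y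
        obtain ⟨c, hc, z, hz⟩ := ih w
        refine ⟨Fin.cons t c, Fin.cases ht hc, z, ?_⟩
        rw [Fin.sum_univ_succ]
        simp only [Fin.cons_zero, Fin.cons_succ, Fin.val_zero, pow_zero, mul_one, Fin.val_succ]
        rw [sub_eq_iff_eq_add.1 hw, hz, mul_add, Finset.mul_sum]
        have : ∀ i : Fin n, (p : GR p r s) * (c i * (p : GR p r s) ^ (i : ℕ)) =
            c i * (p : GR p r s) ^ ((i : ℕ) + 1) := fun i => by ring
        simp only [this]
        ring
    obtain ⟨c, hc, z, hz⟩ := key r x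
    exact ⟨c, hc, by rw [hz, GR.natCast_pow_eq_zero, zero_mul, add_zero]⟩

/-- The Teichmüller digits `α₀, …, α_{r-1}` of `α = α₀ + α₁ p + ⋯ + α_{r-1} p^(r-1)`. -/
noncomputable def teichmullerDigit (p : ℕ) [Fact p.Prime] (r s : ℕ) (α : GR p r s) :
    Fin r → GR p r s :=
  (GR.exists_expansion p r s α).choose

/-- For even `s`, the map `α ↦ ᾱ = α₀^(p^(s/2)) + α₁^(p^(s/2)) p + ⋯ + α_{r-1}^(p^(s/2)) p^(r-1)`
of `GR(p^r, s)`. -/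
noncomputable def conjGR (p : ℕ) [Fact p.Prime] (r s : ℕ) (α : GR p r s) : GR p r s :=
  ∑ i : Fin r, teichmullerDigit p r s α i ^ p ^ (s / 2) * (p : GR p r s) ^ (i : ℕ)

/-! ### Abelian codes (ideals of a group ring) and their duals -/

/-- The Euclidean form `⟨u, v⟩_E = ∑ u_g v_g` on `R[G]`. -/
def euclideanForm {R G : Type*} [CommRing R] [Fintype G] (u v : R[G]) : R :=
  ∑ g, u.coeff g * v.coeff g

/-- The Hermitian form `⟨u, v⟩_H = ∑ u_g v̄_g` on `GR(p^r, s)[G]` (`s` even). -/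
noncomputable def hermitianForm (p : ℕ) [Fact p.Prime] (r s : ℕ) {G : Type*} [Fintype G]
    (u v : (GR p r s)[G]) : GR p r s :=
  ∑ g, u.coeff g * conjGR p r s (v.coeff g)

/-- The Euclidean dual of a subset of `R[G]`. -/
def euclideanDual {R G : Type*} [CommRing R] [Fintype G] (C : Set R[G]) : Set R[G] :=
  {v | ∀ u ∈ C, euclideanForm u v = 0}

/-- The Hermitian dual of a subset of `GR(p^r, s)[G]` (`s` even). -/
def hermitianDual (p : ℕ) [Fact p.Prime] (r s : ℕ) {G : Type*} [Fintype G]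
    (C : Set (GR p r s)[G]) : Set (GR p r s)[G] :=
  {v | ∀ u ∈ C, hermitianForm p r s u v = 0}

/-- The number of abelian codes in `GR(p^r, s)[G]`. -/
noncomputable def NA (p : ℕ) [Fact p.Prime] (r s : ℕ) (G : Type*) [AddCommGroup G] : ℕ :=
  Nat.card (Ideal (GR p r s)[G])

/-- The number of Euclidean self-dual abelian codes in `GR(p^r, s)[G]`. -/
noncomputable def NEA (p : ℕ) [Fact p.Prime] (r s : ℕ) (G : Type*) [AddCommGroup G] [Fintype G] :
    ℕ :=
  Nat.card {C : Ideal (GR p r s)[G] // (C : Set (GR p r s)[G]) = euclideanDual C}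

/-- The number of Hermitian self-dual abelian codes in `GR(p^r, s)[G]` (`s` even). -/
noncomputable def NHA (p : ℕ) [Fact p.Prime] (r s : ℕ) (G : Type*) [AddCommGroup G] [Fintype G] :
    ℕ :=
  Nat.card {C : Ideal (GR p r s)[G] // (C : Set (GR p r s)[G]) = hermitianDual p r s C}

/-! ### Arithmetic of the exponents -/

/-- The multiplicative order `ord_d(q)` of `q` modulo `d` (for `gcd(d, q) = 1`). -/
noncomputable def ordMod (d q : ℕ) : ℕ := orderOf (q : ZMod d)

/-- The number of elements of order `d` of the additive group `A`. -/
noncomputable def numOrder (A : Type*) [AddCommGroup A] (d : ℕ) : ℕ :=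
  Nat.card {a : A // addOrderOf a = d}

/-- `(j, q)` is oddly good: `j` divides `q^t + 1` for some odd `t ≥ 1`. -/
def OddlyGood (j q : ℕ) : Prop := ∃ t, 1 ≤ t ∧ Odd t ∧ j ∣ q ^ t + 1

/-- `(j, q)` is evenly good: `j` divides `q^t + 1` for some even `t ≥ 2`. -/
def EvenlyGood (j q : ℕ) : Prop := ∃ t, 2 ≤ t ∧ Even t ∧ j ∣ q ^ t + 1

/-- `(j, q)` is good: it is oddly good or evenly good. -/
def IsGood (j q : ℕ) : Prop := OddlyGood j q ∨ EvenlyGood j q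

open Classical in
/-- `χ(j, q) = 0` if `(j, q)` is good, and `1` otherwise. -/
noncomputable def chi (j q : ℕ) : ℕ := if IsGood j q then 0 else 1

open Classical in
/-- `λ(j, q) = 0` if `(j, q)` is oddly good, and `1` otherwise. -/
noncomputable def lam (j q : ℕ) : ℕ := if OddlyGood j q then 0 else 1

/-! ### Residue map, lifting and rigidity of Galois rings -/

namespace GR

variable (p : ℕ) [Fact p.Prime] (r n : ℕ)

/-! The dual of a code for either form is the annihilator of the code pulled back along the twist `∑
α_g Y^g ↦ ∑ c(α_g) Y^(-g)`, where `c` is the identity or the conjugation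
(`setOf_form_eq_comap_annihilator`). Self-dual codes are therefore ideals `C = σ⁻¹(Ann C)` for an
involution `σ` of the group ring.

Since `p ∤ |A|`, the characters of `A` with values in the algebraic closure of `𝔽_p` separate
coefficients. Write `q = p^s`. The group ring of `A × P` splits into components `GR(p^r,
s·ord_d(q))[P]`, one for each orbit of characters under `χ ↦ χ^q`, with `d` the order of `χ`
(`componentHom_bijective`). The characters form a group isomorphic to `A`, so there are `N_A(d) /
ord_d(q)` orbits of order `d`.

The twist permutes the components by `χ ↦ χ^(-u)`, with `u = 1` in the Euclidean and `u = p^(s/2)`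
in the Hermitian case. On two swapped components one ideal is arbitrary and determines the other,
because double annihilators are trivial in `GR(p^r, n)[P]` (`annihilator_annihilator`); this gives
the factors `NA`. A component is fixed iff `d ∣ u q^i + 1` for some `i`, that is, iff `d` is good,
respectively oddly good. The twist then acts on its coefficients as a power of Frobenius whose
exponent is, modulo the degree, `0` or half the degree; this gives the factors `NEA` and `NHA`.

Maps of Galois rings are handled through residues: they are determined by their reduction modulo `p`
(`ringHom_ext_residue`), and they can be lifted from it (`exists_lift`). -/

theorem monic_map : ((basicIrreducible p n).map (Int.castRingHom (ZMod (p ^ r)))).Monic :=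
  (basicIrreducible_monic p n).map _

theorem natDegree_map [NeZero r] :
    ((basicIrreducible p n).map (Int.castRingHom (ZMod (p ^ r)))).natDegree = n := by
  have : Fact (1 < p ^ r) := ⟨Nat.one_lt_pow (NeZero.ne r) (Fact.out : p.Prime).one_lt⟩
  rw [(basicIrreducible_monic p n).natDegree_map, basicIrreducible_natDegree]

instance : NeZero (p ^ r) := ⟨pow_ne_zero _ (Fact.out : p.Prime).ne_zero⟩

instance : Finite (GR p r n) := by
  have : Module.Finite (ZMod (p ^ r)) (GR p r n) := (monic_map p r n).finite_adjoinRoot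
  exact Module.finite_of_finite (ZMod (p ^ r))

theorem card [NeZero r] : Nat.card (GR p r n) = p ^ (r * n) := by
  have : Fintype (GR p r n) := Fintype.ofFinite _
  rw [Nat.card_eq_fintype_card, Module.card_fintype (AdjoinRoot.powerBasisAux' (monic_map p r n)),
    ZMod.card, Fintype.card_fin, natDegree_map, pow_mul]

variable {p r n}

theorem isNilpotent_natCast : IsNilpotent (p : GR p r n) := ⟨r, natCast_pow_eq_zero p r n⟩

/-- The annihilator of `p ^ i` in `GR(p^r, n)` is generated by `p ^ (r - i)`. -/
theorem pow_dvd_of_pow_mul_eq_zero {i j : ℕ} (hij : i + j = r) {y : GR p r n}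
    (h : (p : GR p r n) ^ i * y = 0) : (p : GR p r n) ^ j ∣ y := by
  have b := AdjoinRoot.powerBasisAux' (monic_map p r n)
  have key : ∀ c : ZMod (p ^ r), (p : ZMod (p ^ r)) ^ i * c = 0 →
      ∃ d, (p : ZMod (p ^ r)) ^ j * d = c := by
    intro c hc
    obtain ⟨m, rfl⟩ := ZMod.natCast_zmod_surjective c
    have h1 : p ^ r ∣ p ^ i * m := by
      rw [← ZMod.natCast_eq_zero_iff]; exact_mod_cast hc
    rw [← hij, pow_add] at h1
    obtain ⟨d, rfl⟩ :=
      (Nat.mul_dvd_mul_iff_left (pow_pos (Fact.out : p.Prime).pos i)).1 h1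
    exact ⟨d, by push_cast; rfl⟩
  have hsm : ∀ (k : ℕ) (z : GR p r n), (p : GR p r n) ^ k * z = ((p : ZMod (p ^ r)) ^ k) • z := by
    intro k z
    rw [Algebra.smul_def, map_pow, map_natCast]
  have h2 : ∀ l, (p : ZMod (p ^ r)) ^ i * b.repr y l = 0 := by
    intro l
    have := congrArg (fun z => b.repr z l) h
    rw [hsm] at this
    simpa using this
  choose d hd using fun l => key _ (h2 l)
  refine ⟨∑ l, d l • b l, ?_⟩
  rw [hsm, Finset.smul_sum]
  conv_lhs => rw [← b.sum_repr y]
  exact Finset.sum_congr rfl fun l _ => by rw [← hd, mul_smul]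

variable (p r n)

/-- All residue fields are embedded in one algebraic closure, so that maps between different Galois
rings can be compared there. The image is identified by its equation `y ^ p ^ n = y`. -/
theorem exists_residueHom [NeZero r] [NeZero n] :
    ∃ ρ : GR p r n →+* AlgebraicClosure (ZMod p),
      (∀ x, ρ x = 0 ↔ (p : GR p r n) ∣ x) ∧ ∀ y, (∃ x, ρ x = y) ↔ y ^ p ^ n = y := by
  set K := AlgebraicClosure (ZMod p)
  set g := basicIrreducible p n with hg
  set gb := g.map (Int.castRingHom (ZMod p)) with hgb
  have hirr : Irreducible gb := basicIrreducible_irreducible p n (NeZero.ne n)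
  have : Fact (Irreducible gb) := ⟨hirr⟩
  have hmon : gb.Monic := (basicIrreducible_monic p n).map _
  have hdeg : gb.natDegree = n := by
    rw [hgb, (basicIrreducible_monic p n).natDegree_map, basicIrreducible_natDegree]
  obtain ⟨a, ha⟩ := IsAlgClosed.exists_aeval_eq_zero K gb hirr.degree_pos.ne'
  let ι : AdjoinRoot gb →+* K := AdjoinRoot.lift (algebraMap (ZMod p) K) a ha
  let c : ZMod (p ^ r) →+* ZMod p := ZMod.castHom (dvd_pow_self p (NeZero.ne r)) (ZMod p)
  have hc : (g.map (Int.castRingHom (ZMod (p ^ r)))).map c = gb := by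
    rw [Polynomial.map_map, hgb]
    congr 1
    exact RingHom.ext_int _ _
  let π : GR p r n →+* AdjoinRoot gb := AdjoinRoot.map c _ _ (by rw [hc])
  have hπ : ∀ h : ℤ[X], π (AdjoinRoot.mk _ (h.map (Int.castRingHom (ZMod (p ^ r))))) =
      AdjoinRoot.mk gb (h.map (Int.castRingHom (ZMod p))) := by
    intro h
    have : (π.comp (AdjoinRoot.mk _)).comp (mapRingHom (Int.castRingHom (ZMod (p ^ r)))) =
        (AdjoinRoot.mk gb).comp (mapRingHom (Int.castRingHom (ZMod p))) := by
      ext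
      · simp [π]
      · simp [π]
    exact congrArg (fun f => f h) this
  have hπs : Function.Surjective π := by
    intro y
    obtain ⟨h', rfl⟩ := AdjoinRoot.mk_surjective y
    obtain ⟨h, rfl⟩ := map_surjective (Int.castRingHom (ZMod p)) (ZMod.ringHom_surjective _) h'
    exact ⟨_, hπ h⟩
  have hp0 : ((p : ℕ) : AdjoinRoot gb) = 0 := by
    rw [← map_natCast (AdjoinRoot.of gb), CharP.cast_eq_zero, map_zero]
  have hker : ∀ x, π x = 0 ↔ (p : GR p r n) ∣ x := by
    intro x
    constructor
    · obtain ⟨h', rfl⟩ := AdjoinRoot.mk_surjective x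
      obtain ⟨h, rfl⟩ :=
        map_surjective (Int.castRingHom (ZMod (p ^ r))) (ZMod.ringHom_surjective _) h'
      intro hx
      rw [hπ] at hx
      obtain ⟨k', hk'⟩ := AdjoinRoot.mk_eq_zero.1 hx
      obtain ⟨k, rfl⟩ := map_surjective (Int.castRingHom (ZMod p)) (ZMod.ringHom_surjective _) k'
      have hd : (C (p : ℤ)) ∣ h - g * k := by
        rw [C_dvd_iff_dvd_coeff]
        intro i
        rw [← ZMod.intCast_zmod_eq_zero_iff_dvd]
        have : (h - g * k).map (Int.castRingHom (ZMod p)) = 0 := by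
          rw [Polynomial.map_sub, hk', Polynomial.map_mul, sub_self]
        have h2 := congrArg (fun q => q.coeff i) this
        simp only [coeff_map, coeff_zero] at h2
        exact h2
      obtain ⟨m, hm⟩ := hd
      let φ : ℤ[X] →+* GR p r n :=
        (AdjoinRoot.mk (g.map (Int.castRingHom (ZMod (p ^ r))))).comp
          (mapRingHom (Int.castRingHom (ZMod (p ^ r))))
      have h0 : φ g = 0 := AdjoinRoot.mk_self
      have hC : φ (C (p : ℤ)) = (p : GR p r n) := by
        have : (C (p : ℤ) : ℤ[X]) = ((p : ℕ) : ℤ[X]) := by simp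
        rw [this, map_natCast]
      have := congrArg φ hm
      rw [map_sub, map_mul, map_mul, h0, zero_mul, sub_zero, hC] at this
      exact ⟨φ m, this⟩
    · rintro ⟨y, rfl⟩
      rw [map_mul, map_natCast, hp0, zero_mul]
  refine ⟨ι.comp π, fun x => ?_, ?_⟩
  · rw [RingHom.comp_apply, map_eq_zero, hker]
  have : Module.Finite (ZMod p) (AdjoinRoot gb) := hmon.finite_adjoinRoot
  have : Finite (AdjoinRoot gb) := Module.finite_of_finite (ZMod p)
  have : Fintype (AdjoinRoot gb) := Fintype.ofFinite _
  have hcard : Fintype.card (AdjoinRoot gb) = p ^ n := by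
    rw [Module.card_eq_pow_finrank (K := ZMod p), ZMod.card,
      (AdjoinRoot.powerBasis' hmon).finrank, AdjoinRoot.powerBasis'_dim, hdeg]
  have h1 : 1 < p ^ n := Nat.one_lt_pow (NeZero.ne n) (Fact.out : p.Prime).one_lt
  classical
  let s : Finset K := (X ^ p ^ n - X : K[X]).roots.toFinset
  have hs : ∀ y, y ∈ s ↔ y ^ p ^ n = y := by
    intro y
    rw [Multiset.mem_toFinset, mem_roots (FiniteField.X_pow_card_sub_X_ne_zero K h1)]
    simp [IsRoot, sub_eq_zero]
  have hle : s.card ≤ p ^ n := by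
    refine (Multiset.toFinset_card_le _).trans ((card_roots' _).trans ?_)
    rw [FiniteField.X_pow_card_sub_X_natDegree_eq K h1]
  -- The image consists of `p ^ n` roots of `X ^ p ^ n - X`, hence of all of them.
  have him : Finset.univ.image ι = s := by
    refine Finset.eq_of_subset_of_card_le ?_ ?_
    · intro y hy
      obtain ⟨x, -, rfl⟩ := Finset.mem_image.1 hy
      rw [hs, ← map_pow, ← hcard, FiniteField.pow_card]
    · rwa [Finset.card_image_of_injective _ ι.injective, Finset.card_univ, hcard]
  intro y
  rw [← hs, ← him, Finset.mem_image]
  constructor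
  · rintro ⟨x, rfl⟩
    exact ⟨π x, Finset.mem_univ _, rfl⟩
  · rintro ⟨z, -, rfl⟩
    obtain ⟨x, rfl⟩ := hπs z
    exact ⟨x, rfl⟩

/-- Reduction modulo `p`, followed by an embedding of the residue field into an algebraic
closure of `𝔽_p`. -/
noncomputable def residue [NeZero r] [NeZero n] : GR p r n →+* AlgebraicClosure (ZMod p) :=
  (exists_residueHom p r n).choose

variable {p r n}

section
variable [NeZero r] [NeZero n]

theorem residue_eq_zero {x : GR p r n} : residue p r n x = 0 ↔ (p : GR p r n) ∣ x :=
  (exists_residueHom p r n).choose_spec.1 x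

theorem exists_residue_eq {y : AlgebraicClosure (ZMod p)} :
    (∃ x, residue p r n x = y) ↔ y ^ p ^ n = y :=
  (exists_residueHom p r n).choose_spec.2 y

/-- Such an `x` satisfies `x ^ (p ^ n - 1) ≡ 1` modulo `p`, and `1` plus a nilpotent is a unit. -/
theorem isUnit_of_residue_ne_zero {x : GR p r n} (h : residue p r n x ≠ 0) : IsUnit x := by
  have h1 : (p : GR p r n) ∣ x ^ (p ^ n - 1) - 1 := by
    rw [← residue_eq_zero, map_sub, map_pow, map_one, sub_eq_zero]
    have h2 := (exists_residue_eq (r := r)).1 ⟨x, rfl⟩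
    have h3 : 1 ≤ p ^ n := Nat.one_le_pow _ _ (Fact.out : p.Prime).pos
    rw [← Nat.sub_add_cancel h3, pow_succ] at h2
    exact mul_right_cancel₀ h (h2.trans (one_mul _).symm)
  obtain ⟨y, hy⟩ := h1
  have h2 : IsUnit (x ^ (p ^ n - 1)) := by
    rw [sub_eq_iff_eq_add.1 hy]
    exact ((Commute.all (p : GR p r n) y).isNilpotent_mul_right isNilpotent_natCast).isUnit_add_one
  refine (isUnit_pow_iff ?_).1 h2
  have := Nat.one_lt_pow (NeZero.ne n) (Fact.out : p.Prime).one_lt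
  omega

/-- Every element of `GR(p^r, n)` is a unit times a power of `p`. -/
theorem exists_eq_pow_mul (x : GR p r n) :
    ∃ i ≤ r, ∃ u, IsUnit u ∧ x = (p : GR p r n) ^ i * u := by
  by_cases hx : ∃ i < r, ∃ u, IsUnit u ∧ x = (p : GR p r n) ^ i * u
  · obtain ⟨i, hi, h⟩ := hx
    exact ⟨i, hi.le, h⟩
  refine ⟨r, le_rfl, 1, isUnit_one, ?_⟩
  rw [natCast_pow_eq_zero, zero_mul]
  -- By `hx` the cofactor of `p ^ i` is never a unit for `i < r`, so another `p` can always be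
  -- extracted, until `p ^ r = 0` divides `x`.
  have : ∀ i ≤ r, (p : GR p r n) ^ i ∣ x := by
    intro i
    induction i with
    | zero => simp
    | succ i ih =>
      intro hi
      obtain ⟨u, rfl⟩ := ih (by omega)
      by_cases hu : residue p r n u = 0
      · rw [pow_succ]
        exact mul_dvd_mul_left _ (residue_eq_zero.1 hu)
      · exact absurd ⟨i, by omega, u, isUnit_of_residue_ne_zero hu, rfl⟩ hx
  have h := this r le_rfl
  rwa [natCast_pow_eq_zero, zero_dvd_iff] at h

/-- Raising to the power `p ^ k` turns a congruence modulo `p` into one modulo `p ^ (k + 1)`. For `k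
= a * b * r` both elements are unchanged and the modulus is zero. -/
theorem eq_of_pow_eq_of_residue_eq {u v : GR p r n} {a b : ℕ} (ha : a ≠ 0) (hb : b ≠ 0)
    (hu : u ^ p ^ a = u) (hv : v ^ p ^ b = v) (h : residue p r n u = residue p r n v) : u = v := by
  have iter : ∀ (w : GR p r n) (c k : ℕ), w ^ p ^ c = w → w ^ p ^ (c * k) = w := by
    intro w c k hw
    induction k with
    | zero => simp
    | succ k ih => rw [mul_add, mul_one, pow_add, pow_mul, ih, hw]
  have h1 : (p : GR p r n) ∣ u - v := by rw [← residue_eq_zero, map_sub, h, sub_self]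
  have h2 := dvd_sub_pow_of_dvd_sub h1 (a * b * r)
  have h3 : u ^ p ^ (a * b * r) = u := by rw [mul_assoc]; exact iter u a _ hu
  have h4 : v ^ p ^ (a * b * r) = v := by rw [mul_comm a b, mul_assoc]; exact iter v b _ hv
  rw [h3, h4] at h2
  have hle : r ≤ a * b * r + 1 :=
    (Nat.le_mul_of_pos_left r (Nat.pos_of_ne_zero (mul_ne_zero ha hb))).trans (Nat.le_succ _)
  rw [← Nat.add_sub_of_le hle, pow_add, natCast_pow_eq_zero, zero_mul, zero_dvd_iff,
    sub_eq_zero] at h2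
  exact h2

end

section
variable {m : ℕ} [NeZero n]

theorem pow_card_of_ringHom (θ : GR p r n →+* AlgebraicClosure (ZMod p)) (x : GR p r n) :
    θ x ^ p ^ n = θ x := by
  obtain ⟨y, hy⟩ := dvd_pow_sub_self p r n (NeZero.ne n) x
  have := congrArg θ hy
  rw [map_sub, map_pow, map_mul, map_natCast, CharP.cast_eq_zero, zero_mul, sub_eq_zero] at this
  exact this

variable [NeZero r] [NeZero m]

/-- Homomorphisms between Galois rings are determined by their reduction modulo `p`. -/
theorem ringHom_ext_residue {f g : GR p r n →+* GR p r m}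
    (h : ∀ x, residue p r m (f x) = residue p r m (g x)) : f = g := by
  refine RingHom.ext fun x => ?_
  obtain ⟨c, hc, rfl⟩ := exists_expansion p r n x
  rw [map_sum, map_sum]
  refine Finset.sum_congr rfl fun i _ => ?_
  rw [map_mul, map_mul, map_pow, map_natCast, map_pow, map_natCast]
  congr 1
  -- Powers of `p` are preserved, so only Teichmüller digits matter; their images are again fixed by
  -- the `p ^ n`-th power, hence determined by residues.
  refine eq_of_pow_eq_of_residue_eq (NeZero.ne n) (NeZero.ne n) ?_ ?_ (h _)
  · rw [← map_pow, hc i]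
  · rw [← map_pow, hc i]

/-- Lifting of homomorphisms from the residue field. -/
theorem exists_lift (θ : GR p r n →+* AlgebraicClosure (ZMod p)) (hnm : n ∣ m) :
    ∃ f : GR p r n →+* GR p r m, ∀ x, residue p r m (f x) = θ x := by
  set g := (basicIrreducible p n).map (Int.castRingHom (ZMod (p ^ r))) with hg
  set gb := (basicIrreducible p n).map (Int.castRingHom (ZMod p)) with hgb
  obtain ⟨k, rfl⟩ := hnm
  have hpow : ∀ j x, θ x ^ p ^ (n * j) = θ x := by
    intro j x
    induction j with
    | zero => simp
    | succ j ih => rw [mul_add, mul_one, pow_add, pow_mul, ih, pow_card_of_ringHom]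
  -- `b` is an approximate root, modulo `p`, of the defining polynomial of the source.
  obtain ⟨b, hb⟩ := exists_residue_eq (r := r).2 (hpow k (AdjoinRoot.root g))
  have hres : ∀ h : ℤ[X], residue p r (n * k) (aeval b h) = θ (aeval (AdjoinRoot.root g) h) := by
    intro h
    have e : ((residue p r (n * k)).comp (aeval b : ℤ[X] →ₐ[ℤ] _).toRingHom) =
        θ.comp (aeval (AdjoinRoot.root g) : ℤ[X] →ₐ[ℤ] _).toRingHom := by
      ext
      · simp
      · simpa using hb
    exact congrArg (fun f => f h) e
  have hroot : aeval (AdjoinRoot.root g) (basicIrreducible p n) = 0 := by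
    have := AdjoinRoot.eval₂_root g
    rw [hg, eval₂_map] at this
    exact (congrArg (fun i : ℤ →+* _ => eval₂ i _ _) (RingHom.ext_int _ _)).trans this
  have hnil : IsNilpotent (aeval b (basicIrreducible p n)) := by
    have h1 := hres (basicIrreducible p n)
    rw [hroot, map_zero, residue_eq_zero] at h1
    obtain ⟨y, hy⟩ := h1
    rw [hy]
    exact (Commute.all (p : GR p r (n * k)) y).isNilpotent_mul_right isNilpotent_natCast
  have hirr : Irreducible gb := basicIrreducible_irreducible p n (NeZero.ne n)
  have hθ : ∀ h : ℤ[X], θ (aeval (AdjoinRoot.root g) h) =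
      aeval (θ (AdjoinRoot.root g)) (h.map (Int.castRingHom (ZMod p))) := by
    intro h
    have e : θ.comp (aeval (AdjoinRoot.root g) : ℤ[X] →ₐ[ℤ] _).toRingHom =
        (aeval (θ (AdjoinRoot.root g)) : (ZMod p)[X] →ₐ[ZMod p] _).toRingHom.comp
          (mapRingHom (Int.castRingHom (ZMod p))) := by
      ext
      · simp
      · simp
    exact congrArg (fun f => f h) e
  have hunit : IsUnit (aeval b (derivative (basicIrreducible p n))) := by
    apply isUnit_of_residue_ne_zero
    rw [hres, hθ, ← derivative_map]
    refine (PerfectField.separable_of_irreducible hirr).aeval_derivative_ne_zero ?_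
    rw [← hθ, hroot, map_zero]
  -- Newton iteration: separability modulo `p` makes the derivative at `b` a unit, so `b` can be
  -- corrected by a nilpotent to an exact root.
  obtain ⟨c, ⟨hc1, hc2⟩, -⟩ := existsUnique_nilpotent_sub_and_aeval_eq_zero hnil hunit
  have hcb : residue p r (n * k) c = θ (AdjoinRoot.root g) := by
    have h1 : residue p r (n * k) (b - c) = 0 := (hc1.map (residue p r (n * k))).eq_zero
    rw [← hb, eq_comm, ← sub_eq_zero, ← map_sub, h1]
  let f : GR p r n →+* GR p r (n * k) :=
    AdjoinRoot.lift (algebraMap (ZMod (p ^ r)) _) c (by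
      rw [eval₂_map]
      exact (congrArg (fun i : ℤ →+* _ => eval₂ i _ _) (RingHom.ext_int _ _)).trans hc2)
  refine ⟨f, fun x => ?_⟩
  have : (residue p r (n * k)).comp f = θ := by
    apply AdjoinRoot.ringHom_ext
    · exact RingHom.ext_zmod _ _
    · simpa [f] using hcb
  exact congrArg (fun f => f x) this

/-- The Teichmüller lift of a root of unity of the residue field. -/
theorem exists_teichmuller_residue_eq {y : AlgebraicClosure (ZMod p)} (hy : y ^ p ^ n = y) :
    ∃ t : GR p r n, t ^ p ^ n = t ∧ residue p r n t = y := by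
  obtain ⟨x, rfl⟩ := exists_residue_eq (r := r).2 hy
  obtain ⟨t, ht, h⟩ := exists_teichmuller p r n (NeZero.ne n) x
  refine ⟨t, ht, ?_⟩
  rw [← residue_eq_zero, map_sub, sub_eq_zero] at h
  exact h.symm

end

section
variable [NeZero r] [NeZero n]

/-- The lift of the `i`-th power of the Frobenius automorphism of the residue field. -/
theorem exists_frobenius (r n : ℕ) [NeZero r] [NeZero n] (i : ℕ) :
    ∃ f : GR p r n →+* GR p r n, ∀ x, residue p r n (f x) = residue p r n x ^ p ^ i :=
  exists_lift ((iterateFrobenius (AlgebraicClosure (ZMod p)) p i).comp (residue p r n)) dvd_rfl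

/-- The conjugation `α ↦ ᾱ` is the lift of the `n / 2`-th power of Frobenius. -/
theorem conjGR_eq_of_residue {f : GR p r n →+* GR p r n}
    (hf : ∀ x, residue p r n (f x) = residue p r n x ^ p ^ (n / 2)) (x : GR p r n) :
    conjGR p r n x = f x := by
  -- Only two facts about the chosen digits are used: they are Teichmüller and they expand `x`.
  -- Uniqueness of the expansion is not needed.
  obtain ⟨hc, hx⟩ := (exists_expansion p r n x).choose_spec
  change ∀ i, teichmullerDigit p r n x i ∈ _ at hc
  change x = ∑ i, teichmullerDigit p r n x i * _ at hx
  conv_rhs => rw [hx]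
  rw [conjGR, map_sum]
  refine Finset.sum_congr rfl fun i _ => ?_
  rw [map_mul, map_pow, map_natCast]
  congr 1
  have h : teichmullerDigit p r n x i ^ p ^ n = teichmullerDigit p r n x i := hc i
  refine eq_of_pow_eq_of_residue_eq (NeZero.ne n) (NeZero.ne n) ?_ ?_ ?_
  · rw [← pow_mul, mul_comm, pow_mul, h]
  · rw [← map_pow, h]
  · rw [hf, map_pow]

end

end GR

/-! ### Duals of abelian codes as annihilators -/

section Twist

variable {R R' : Type*} [CommRing R] [CommRing R'] {G : Type*} [AddCommGroup G]

/-- The homomorphism `∑ α_g Y^g ↦ ∑ c(α_g) Y^(-g)` of group rings. -/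
noncomputable def twist (G : Type*) [AddCommGroup G] (c : R →+* R') : R[G] →+* R'[G] :=
  (AddMonoidAlgebra.mapDomainRingHom R' (negAddMonoidHom : G →+ G)).comp
    (AddMonoidAlgebra.mapRingHom G c)

theorem coeff_twist (c : R →+* R') (u : R[G]) (g : G) :
    (twist G c u).coeff g = c (u.coeff (-g)) := by
  have := Finsupp.mapDomain_apply (f := fun g : G => -g) neg_injective
    (AddMonoidAlgebra.mapRingHom G c u).coeff (-g)
  rw [neg_neg, AddMonoidAlgebra.coeff_mapRingHom] at this
  exact this

theorem twist_twist {c : R →+* R} (hc : ∀ x, c (c x) = x) (u : R[G]) :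
    twist G c (twist G c u) = u := by
  ext g
  rw [coeff_twist, coeff_twist, hc, neg_neg]

variable [Fintype G]

theorem AddMonoidAlgebra.coeff_mul_eq_sum (u v : R[G]) (h : G) :
    (u * v).coeff h = ∑ g, u.coeff g * v.coeff (-g + h) := by
  rw [AddMonoidAlgebra.coeff_mul_apply_left]
  exact Finsupp.sum_fintype _ _ (by simp)

/-- This converts products into forms: each coefficient of `twist v * u` pairs a translate of `u`
with `v`. -/
theorem coeff_twist_mul (c : R →+* R') (v : R[G]) (u : R'[G]) (h : G) :
    (twist G c v * u).coeff h = ∑ g, (AddMonoidAlgebra.single (-h) 1 * u).coeff g * c (v.coeff g) := by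
  rw [AddMonoidAlgebra.coeff_mul_eq_sum]
  refine (_root_.Equiv.sum_comp (Equiv.neg G) _).symm.trans ?_
  refine Finset.sum_congr rfl fun g _ => ?_
  rw [coeff_twist, AddMonoidAlgebra.coeff_single_mul_apply]
  simp [mul_comm, add_comm]

/-- The dual of an ideal with respect to a sesquilinear form is its annihilator, conjugated. -/
theorem setOf_form_eq_comap_annihilator (c : R →+* R) (C : Ideal R[G]) :
    {v : R[G] | ∀ u ∈ (C : Set R[G]), ∑ g, u.coeff g * c (v.coeff g) = 0} =
      (C.annihilator.comap (twist G c) : Ideal R[G]) := by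
  ext v
  simp only [Set.mem_ofPred_eq, SetLike.mem_coe, Ideal.mem_comap, Submodule.mem_annihilator,
    smul_eq_mul]
  constructor
  · intro h u hu
    ext k
    -- An ideal contains all translates of its elements, so orthogonality kills every coefficient of
    -- the product, not only the one at `0`.
    rw [coeff_twist_mul, h _ (C.mul_mem_left _ hu)]
    rfl
  · intro h u hu
    have := coeff_twist_mul c v u 0
    rw [h u hu, neg_zero, ← AddMonoidAlgebra.one_def, one_mul] at this
    exact this.symm

end Twist

/-- The number of ideals that equal their annihilator, pulled back along `σ`. -/
noncomputable def selfDualCard {S : Type*} [CommRing S] (σ : S →+* S) : ℕ :=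
  Nat.card {C : Ideal S // C = C.annihilator.comap σ}

section

variable (p : ℕ) [Fact p.Prime] (r n : ℕ) {G : Type*} [AddCommGroup G] [Fintype G]

theorem NEA_eq_selfDualCard :
    NEA p r n G = selfDualCard (twist G (RingHom.id (GR p r n))) := by
  refine Nat.card_congr (Equiv.subtypeEquivRight fun C => ?_)
  have : euclideanDual (C : Set (GR p r n)[G]) = _ :=
    setOf_form_eq_comap_annihilator (RingHom.id (GR p r n)) C
  rw [this, SetLike.coe_set_eq]

theorem NHA_eq_selfDualCard {c : GR p r n →+* GR p r n} (hc : ∀ x, conjGR p r n x = c x) :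
    NHA p r n G = selfDualCard (twist G c) := by
  refine Nat.card_congr (Equiv.subtypeEquivRight fun C => ?_)
  have : hermitianDual p r n (C : Set (GR p r n)[G]) =
      (C.annihilator.comap (twist G c) : Ideal (GR p r n)[G]) := by
    rw [← setOf_form_eq_comap_annihilator]
    simp only [hermitianDual, hermitianForm, hc]
  rw [this, SetLike.coe_set_eq]

end

/-! ### The double annihilator property -/

namespace GR

variable {p : ℕ} [Fact p.Prime] {r n : ℕ} [NeZero r] [NeZero n]

theorem exists_eq_span_pow (I : Ideal (GR p r n)) :
    ∃ i ≤ r, I = Ideal.span {(p : GR p r n) ^ i} := by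
  classical
  have hex : ∃ i, (p : GR p r n) ^ i ∈ I := ⟨r, by rw [natCast_pow_eq_zero]; exact I.zero_mem⟩
  refine ⟨Nat.find hex, Nat.find_min' hex (by rw [natCast_pow_eq_zero]; exact I.zero_mem),
    le_antisymm (fun x hx => ?_) ?_⟩
  · obtain ⟨j, -, u, hu, rfl⟩ := exists_eq_pow_mul x
    have hj : (p : GR p r n) ^ j ∈ I := (Ideal.mul_unit_mem_iff_mem I hu).1 hx
    rw [Ideal.mem_span_singleton]
    exact Dvd.dvd.mul_right (pow_dvd_pow _ (Nat.find_min' hex hj)) _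
  · rw [Ideal.span_singleton_le_iff_mem]
    exact Nat.find_spec hex

/-- A map out of `(p ^ i)` sends `p ^ i` to something killed by `p ^ (r - i)`, hence to a multiple
`p ^ i * z`; multiplication by `z` extends it. -/
theorem baer : Module.Baer (GR p r n) (GR p r n) := by
  intro I g
  obtain ⟨i, hi, rfl⟩ := exists_eq_span_pow I
  set x : Ideal.span {(p : GR p r n) ^ i} := ⟨_, Ideal.mem_span_singleton_self _⟩ with hx
  have h0 : (p : GR p r n) ^ (r - i) * g x = 0 := by
    rw [← smul_eq_mul, ← map_smul, ← map_zero g]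
    congr 1
    ext
    rw [hx, Submodule.coe_smul, smul_eq_mul, ← pow_add, Nat.sub_add_cancel hi,
      natCast_pow_eq_zero, Submodule.coe_zero]
  obtain ⟨z, hz⟩ := pow_dvd_of_pow_mul_eq_zero (Nat.sub_add_cancel hi) h0
  refine ⟨LinearMap.toSpanSingleton _ _ z, fun y hy => ?_⟩
  obtain ⟨w, rfl⟩ := Ideal.mem_span_singleton'.1 hy
  have : (⟨w * (p : GR p r n) ^ i, hy⟩ : Ideal.span {(p : GR p r n) ^ i}) = w • x := rfl
  rw [this, map_smul, hz, LinearMap.toSpanSingleton_apply, smul_eq_mul, smul_eq_mul, mul_assoc]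

theorem pow_ne_zero_of_lt {i : ℕ} (hi : i < r) : (p : GR p r n) ^ i ≠ 0 := by
  intro h
  obtain ⟨z, hz⟩ := pow_dvd_of_pow_mul_eq_zero (y := (1 : GR p r n)) (Nat.add_sub_cancel' hi.le)
    (by rw [h, zero_mul])
  have := congrArg (residue p r n) hz
  rw [map_one, map_mul, map_pow, map_natCast, CharP.cast_eq_zero, zero_pow (by omega),
    zero_mul] at this
  exact one_ne_zero this

/-- `GR(p^r, n)` is a cogenerator. -/
theorem exists_linearMap_ne_zero {Q : Type*} [AddCommGroup Q] [Module (GR p r n) Q] {v : Q}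
    (hv : v ≠ 0) : ∃ f : Q →ₗ[GR p r n] GR p r n, f v ≠ 0 := by
  obtain ⟨i, hi, hI⟩ := exists_eq_span_pow (LinearMap.ker (LinearMap.toSpanSingleton (GR p r n) Q v))
  have hi0 : i ≠ 0 := by
    rintro rfl
    have : (1 : GR p r n) ∈ LinearMap.ker (LinearMap.toSpanSingleton (GR p r n) Q v) := by
      rw [hI, pow_zero]; exact Ideal.mem_span_singleton_self _
    rw [LinearMap.mem_ker, LinearMap.toSpanSingleton_apply, one_smul] at this
    exact hv this
  -- The annihilator of `v` is `(p ^ i)` with `i > 0`, so `v ↦ p ^ (r - i) ≠ 0` is well defined on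
  -- the span of `v`; self-injectivity extends it to `Q`.
  have hle : LinearMap.ker (LinearMap.toSpanSingleton (GR p r n) Q v) ≤
      LinearMap.ker (LinearMap.toSpanSingleton (GR p r n) (GR p r n) ((p : GR p r n) ^ (r - i))) := by
    rw [hI, Ideal.span_singleton_le_iff_mem, LinearMap.mem_ker, LinearMap.toSpanSingleton_apply,
      smul_eq_mul, ← pow_add, Nat.add_sub_cancel' hi, natCast_pow_eq_zero]
  obtain ⟨f, hf⟩ := baer.extension_property
    ((LinearMap.ker (LinearMap.toSpanSingleton (GR p r n) Q v)).liftQ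
      (LinearMap.toSpanSingleton (GR p r n) Q v) le_rfl)
    (LinearMap.ker_eq_bot.1 (Submodule.ker_liftQ_eq_bot' _ _ rfl))
    ((LinearMap.ker (LinearMap.toSpanSingleton (GR p r n) Q v)).liftQ _ hle)
  refine ⟨f, ?_⟩
  have h1 := congrArg (fun g => g (Submodule.Quotient.mk 1)) hf
  simp only [LinearMap.comp_apply, Submodule.liftQ_apply, LinearMap.toSpanSingleton_apply,
    one_smul] at h1
  rw [h1]
  have := NeZero.pos r
  exact pow_ne_zero_of_lt (by omega)

/-- If `v ∉ J`, some linear functional vanishes on `J` but not at `v`. It has the form `u ↦ ∑ u_g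
w_g`, so the twist of `w` annihilates the ideal `J` but not `v`. -/
theorem annihilator_annihilator {G : Type*} [AddCommGroup G] [Fintype G]
    (J : Ideal (GR p r n)[G]) : J.annihilator.annihilator = J := by
  refine le_antisymm (fun v hv => ?_) fun v hv => ?_
  · by_contra hvJ
    let JR : Submodule (GR p r n) (GR p r n)[G] := J.restrictScalars _
    obtain ⟨f, hf⟩ := exists_linearMap_ne_zero (p := p) (r := r) (n := n) (Q := (GR p r n)[G] ⧸ JR)
      (mt (Submodule.Quotient.mk_eq_zero JR).1 hvJ)
    let w : (GR p r n)[G] :=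
      .ofCoeff (Finsupp.equivFunOnFinite.symm
        fun g => f (JR.mkQ (AddMonoidAlgebra.single g 1)))
    have hw : ∀ u : (GR p r n)[G], f (JR.mkQ u) = ∑ g, u.coeff g * w.coeff g := by
      intro u
      have hu : u = ∑ g, u.coeff g • AddMonoidAlgebra.single g (1 : GR p r n) := by
        conv_lhs => rw [← AddMonoidAlgebra.sum_coeff_single u]
        rw [Finsupp.sum_fintype _ _ (by simp)]
        simp
      conv_lhs => rw [hu]
      rw [map_sum, map_sum]
      refine Finset.sum_congr rfl fun g _ => ?_
      rw [map_smul, map_smul, smul_eq_mul]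
      rfl
    have hmem : twist G (RingHom.id _) w ∈ J.annihilator := by
      rw [Submodule.mem_annihilator]
      intro u hu
      ext h
      rw [smul_eq_mul, coeff_twist_mul]
      simp only [RingHom.id_apply]
      rw [← hw]
      have : JR.mkQ (AddMonoidAlgebra.single (-h) 1 * u) = 0 :=
        (Submodule.Quotient.mk_eq_zero JR).2 (J.mul_mem_left _ hu)
      rw [this, map_zero]
      rfl
    have h0 := (Submodule.mem_annihilator.1 hv) _ hmem
    have h1 := coeff_twist_mul (RingHom.id _) w v 0
    rw [mul_comm, ← smul_eq_mul, h0, neg_zero, ← AddMonoidAlgebra.one_def, one_mul] at h1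
    simp only [RingHom.id_apply] at h1
    rw [← hw] at h1
    exact hf h1.symm
  · rw [Submodule.mem_annihilator]
    intro u hu
    rw [smul_eq_mul, mul_comm, ← smul_eq_mul]
    exact Submodule.mem_annihilator.1 hu v hv

end GR

/-! ### Self-dual ideals of a product of rings permuted by an involution -/

/-- Families that are compatible with an involution `τ` of the index set are determined by the
members at the fixed points and at one point of each two-element orbit. -/
theorem card_compatible_families {X : Type*} [Fintype X] [LinearOrder X] {τ : X → X}
    (hτ : Function.Involutive τ) {L : X → Type*} (D : ∀ x y, τ x = y → L y → L x)
    (hD : ∀ x y (h : τ x = y) (h' : τ y = x) (J : L x), D x y h (D y x h' J) = J) :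
    Nat.card {F : ∀ x, L x // ∀ x y (h : τ x = y), F x = D x y h (F y)} =
      (∏ x : {x // τ x = x}, Nat.card {J : L x // J = D x x x.2 J}) *
        ∏ x : {x // x < τ x}, Nat.card (L x) := by
  classical
  rw [← Nat.card_pi, ← Nat.card_pi, ← Nat.card_prod]
  refine Nat.card_congr (Equiv.ofBijective
    (fun F => (fun x => ⟨F.1 x, F.2 _ _ x.2⟩, fun x => F.1 x)) ⟨?_, ?_⟩)
  · intro F F' h
    obtain ⟨h1, h2⟩ := Prod.mk.inj h
    ext x
    rcases lt_trichotomy (τ x) x with hx | hx | hx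
    · have := congrFun h2 ⟨τ x, by rwa [hτ x]⟩
      rw [F.2 x _ rfl, F'.2 x _ rfl]
      exact congrArg _ this
    · exact congrArg Subtype.val (congrFun h1 ⟨x, hx⟩)
    · exact congrFun h2 ⟨x, hx⟩
  · rintro ⟨f, g⟩
    -- The smaller point of each two-element orbit carries the free choice and the larger point
    -- receives its transport; the last branch cannot occur.
    let F : ∀ x, L x := fun x =>
      if h : τ x = x then f ⟨x, h⟩ else
      if h : x < τ x then g ⟨x, h⟩ else
      if h : τ x < τ (τ x) then D x (τ x) rfl (g ⟨τ x, h⟩) else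
        (h ((lt_of_le_of_ne (not_lt.1 ‹_›) ‹_›).trans_eq (hτ x).symm)).elim
    have F1 : ∀ x (h : τ x = x), F x = f ⟨x, h⟩ := fun x h => dif_pos h
    have F2 : ∀ x (h : x < τ x), F x = g ⟨x, h⟩ := fun x h =>
      (dif_neg h.ne').trans (dif_pos h)
    have F3 : ∀ x y (e : τ x = y) (h : y < τ y), F x = D x y e (g ⟨y, h⟩) := by
      rintro x y rfl h
      have h' : τ x < x := by rwa [hτ x] at h
      exact (dif_neg h'.ne).trans ((dif_neg h'.not_gt).trans (dif_pos h))
    refine ⟨⟨F, ?_⟩, ?_⟩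
    · intro x y h
      have h' : τ y = x := by rw [← h, hτ x]
      rcases lt_trichotomy y x with hx | hx | hx
      · rw [F3 x y h (by rwa [h']), F2 y (by rwa [h'])]
      · subst hx
        rw [F1 y h]
        exact (f ⟨y, h⟩).2
      · rw [F3 y x h' (by rwa [h]), F2 x (by rwa [h]), hD]
    · refine Prod.ext ?_ ?_
      · funext x
        exact Subtype.ext (F1 x x.2)
      · funext x
        exact F2 x x.2

/-- Annihilators in a product are computed componentwise, and `σ` maps component `x` to component `τ
x`. The maps `e x y` take a proof of `τ x = y`, which avoids transport along `τ (τ x) = x`. -/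
theorem selfDualCard_eq_prod {S X : Type*} [CommRing S] [Fintype X] [LinearOrder X] {τ : X → X}
    (hτ : Function.Involutive τ) {B : X → Type*} [∀ x, CommRing (B x)]
    (hB : ∀ x (J : Ideal (B x)), J.annihilator.annihilator = J) (f : ∀ x, S →+* B x)
    (hf : Function.Bijective fun s x => f x s) {σ : S →+* S} (hσ : ∀ s, σ (σ s) = s)
    (e : ∀ x y, τ x = y → B x →+* B y)
    (he : ∀ x y (h : τ x = y) s, e x y h (f x s) = f y (σ s)) :
    selfDualCard σ = (∏ x : {x // τ x = x}, selfDualCard (e x x x.2)) *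
      ∏ x : {x // x < τ x}, Nat.card (Ideal (B x)) := by
  classical
  have hsurj : ∀ x, Function.Surjective (f x) := by
    intro x b
    obtain ⟨s, hs⟩ := hf.2 (Pi.single x b)
    exact ⟨s, by simpa using congrFun hs x⟩
  have hinv : ∀ x y (h : τ x = y) (h' : τ y = x) b, e y x h' (e x y h b) = b := by
    intro x y h h' b
    obtain ⟨s, rfl⟩ := hsurj x b
    rw [he, he, hσ]
  let D : ∀ x y, τ x = y → Ideal (B y) → Ideal (B x) := fun x y h J =>
    J.annihilator.comap (e x y h)
  have hD : ∀ x y (h : τ x = y) (h' : τ y = x) (J : Ideal (B x)), D x y h (D y x h' J) = J := by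
    intro x y h h' J
    -- Going to the other component and back produces the double annihilator.
    conv_rhs => rw [← hB x J]
    ext b
    simp only [D, Ideal.mem_comap, Submodule.mem_annihilator (N := J.annihilator),
      Submodule.mem_annihilator (N := Ideal.comap (e y x h') J.annihilator), smul_eq_mul]
    constructor
    · intro H d hd
      have := congrArg (e y x h') (H (e x y h d) (by rwa [hinv]))
      rwa [map_mul, hinv, hinv, map_zero] at this
    · intro H c hc
      have := congrArg (e x y h) (H _ hc)
      rwa [map_mul, hinv, map_zero] at this
  rw [selfDualCard]
  change _ = (∏ x : {x // τ x = x}, Nat.card {J // J = D x x x.2 J}) * _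
  rw [← card_compatible_families hτ D hD]
  let Φ : S ≃+* (∀ x, B x) := RingEquiv.ofBijective (RingHom.pi f) hf
  let Ψ : (∀ x, Ideal (B x)) ≃ Ideal S :=
    (Ideal.piOrderIso (R := B)).symm.toEquiv.trans
      { toFun := fun I => I.comap (Φ : S →+* ∀ x, B x)
        invFun := fun I => I.comap (Φ.symm : (∀ x, B x) →+* S)
        left_inv := fun I => by
          ext g
          change Φ (Φ.symm g) ∈ I ↔ g ∈ I
          rw [Φ.apply_symm_apply]
        right_inv := fun I => by
          ext g
          change Φ.symm (Φ g) ∈ I ↔ g ∈ I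
          rw [Φ.symm_apply_apply] }
  have hΨ : ∀ J s, s ∈ Ψ J ↔ ∀ x, f x s ∈ J x := fun J s => Iff.rfl
  symm
  refine Nat.card_congr (Ψ.subtypeEquiv fun J => ?_)
  have key : (Ψ J).annihilator.comap σ = Ψ fun x => D x (τ x) rfl (J (τ x)) := by
    ext s
    simp only [hΨ, D, Ideal.mem_comap, he, Submodule.mem_annihilator, smul_eq_mul]
    constructor
    · intro H x b hb
      -- Test against an element supported on the single component `τ x`.
      obtain ⟨t, ht⟩ := hf.2 (Pi.single (τ x) b)
      have ht' : ∀ y, f y t = (Pi.single (τ x) b : ∀ y, B y) y := congrFun ht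
      have := congrArg (f (τ x)) (H t fun y => ?_)
      · rwa [map_mul, map_zero, ht', Pi.single_eq_same] at this
      · rw [ht']
        rcases eq_or_ne y (τ x) with rfl | hy
        · rwa [Pi.single_eq_same]
        · rw [Pi.single_eq_of_ne hy]
          exact (J y).zero_mem
    · intro H t ht
      refine hf.1 (funext fun y => ?_)
      obtain ⟨x, rfl⟩ := hτ.surjective y
      simp only [map_mul, map_zero]
      exact H x _ (ht _)
  rw [key, Ψ.apply_eq_iff_eq]
  constructor
  · exact fun H => funext fun x => H x _ rfl
  · rintro H x y rfl
    exact congrFun H x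

/-! ### Orbits of a finite abelian group under powers of `q` -/

namespace PowOrbit

variable {Γ : Type*} [CommGroup Γ] {q u : ℕ}

theorem pow_eq_pow_iff_cast (x : Γ) (m n : ℕ) :
    x ^ m = x ^ n ↔ (m : ZMod (orderOf x)) = n := by
  rw [pow_eq_pow_iff_modEq, ZMod.natCast_eq_natCast_iff]

theorem pow_pow_eq_self_iff {x : Γ} (i : ℕ) : x ^ q ^ i = x ↔ ordMod (orderOf x) q ∣ i := by
  conv_lhs => rhs; rw [← pow_one x]
  rw [pow_eq_pow_iff_cast, Nat.cast_pow, Nat.cast_one, ordMod, orderOf_dvd_iff_pow_eq_one]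

theorem coprime_orderOf (hq : (Nat.card Γ).Coprime q) (x : Γ) : q.Coprime (orderOf x) :=
  (Nat.Coprime.coprime_dvd_left (orderOf_dvd_natCard x) hq).symm

theorem orderOf_pow_pow (hq : (Nat.card Γ).Coprime q) (x : Γ) (i : ℕ) : orderOf (x ^ q ^ i) = orderOf x :=
  Nat.Coprime.orderOf_pow ((coprime_orderOf hq x).pow_left i).symm

theorem coprime_orderOf_of_sq (hq : (Nat.card Γ).Coprime q) {a : ℕ} (hu : u * u = q ^ a) (x : Γ) : u.Coprime (orderOf x) := by
  have h := (coprime_orderOf hq x).pow_left a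
  rw [← hu] at h
  exact h.coprime_mul_right

variable [Finite Γ]

theorem ordMod_pos (hq : (Nat.card Γ).Coprime q) (x : Γ) : 0 < ordMod (orderOf x) q := by
  have : NeZero (orderOf x) := ⟨(orderOf_pos x).ne'⟩
  have h : IsOfFinOrder (ZMod.unitOfCoprime q (coprime_orderOf hq x)) := isOfFinOrder_of_finite _
  rw [ordMod, ← ZMod.coe_unitOfCoprime q (coprime_orderOf hq x), orderOf_units]
  exact h.orderOf_pos

/-- Two elements are equivalent if one is a `q ^ i`-th power of the other. -/
def orbitSetoid (hq : (Nat.card Γ).Coprime q) : Setoid Γ where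
  r x y := ∃ i : ℕ, y = x ^ q ^ i
  iseqv :=
    { refl := fun x => ⟨0, by simp⟩
      symm := by
        rintro x _ ⟨i, rfl⟩
        -- Together with `i` this exponent adds up to `i * ordMod (orderOf x) q`, which acts
        -- trivially on `x`.
        refine ⟨i * (ordMod (orderOf x) q - 1), ?_⟩
        rw [← pow_mul, ← pow_add, eq_comm, pow_pow_eq_self_iff]
        refine ⟨i, ?_⟩
        have := ordMod_pos hq x
        conv_lhs => lhs; rw [← mul_one i]
        rw [← mul_add, ← Nat.succ_eq_one_add, Nat.succ_eq_add_one, Nat.sub_add_cancel this, mul_comm]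
      trans := by
        rintro x _ _ ⟨i, rfl⟩ ⟨j, rfl⟩
        exact ⟨i + j, by rw [← pow_mul, ← pow_add]⟩ }

variable (hq : (Nat.card Γ).Coprime q)

/-- The set of orbits. -/
abbrev Orbits : Type _ := Quotient (orbitSetoid hq)

/-- The order of the elements of an orbit. -/
noncomputable def order (x : Orbits hq) : ℕ := orderOf x.out

theorem exists_eq_out_pow (g : Γ) : ∃ i : ℕ, g = (⟦g⟧ : Orbits hq).out ^ q ^ i :=
  Quotient.mk_out (s := orbitSetoid hq) g

theorem order_mk (g : Γ) : order hq ⟦g⟧ = orderOf g := by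
  obtain ⟨i, hi⟩ := exists_eq_out_pow hq g
  conv_rhs => rw [hi]
  rw [orderOf_pow_pow hq]
  rfl

theorem card_fiber [Fintype Γ] [DecidableEq (Orbits hq)] (x : Orbits hq) :
    (Finset.univ.filter fun g : Γ => (⟦g⟧ : Orbits hq) = x).card = ordMod (order hq x) q := by
  rw [← Finset.card_range (ordMod (order hq x) q)]
  symm
  refine Finset.card_bij (fun i _ => x.out ^ q ^ i) ?_ ?_ ?_
  · intro i _
    rw [Finset.mem_filter]
    refine ⟨Finset.mem_univ _, ?_⟩
    conv_rhs => rw [← Quotient.out_eq x]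
    exact (Quotient.sound (s := orbitSetoid hq) ⟨i, rfl⟩).symm
  · have hpos : ∀ i j, i ≤ j → j < ordMod (order hq x) q → x.out ^ q ^ i = x.out ^ q ^ j →
        i = j := by
      intro i j hij hj h
      rw [pow_eq_pow_iff_cast, Nat.cast_pow, Nat.cast_pow] at h
      have hu := ZMod.coe_unitOfCoprime q (coprime_orderOf hq x.out)
      rw [← hu, ← Units.val_pow_eq_pow_val, ← Units.val_pow_eq_pow_val, Units.val_inj] at h
      refine pow_injOn_Iio_orderOf ?_ ?_ h
      · rw [Set.mem_Iio, ← orderOf_units, hu]; exact hij.trans_lt hj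
      · rw [Set.mem_Iio, ← orderOf_units, hu]; exact hj
    intro i hi j hj h
    rw [Finset.mem_range] at hi hj
    rcases le_total i j with hij | hij
    · exact hpos i j hij hj h
    · exact (hpos j i hij hi h.symm).symm
  · intro g hg
    rw [Finset.mem_filter] at hg
    obtain ⟨-, rfl⟩ := hg
    obtain ⟨i, hi⟩ := exists_eq_out_pow hq g
    refine ⟨i % ordMod (order hq ⟦g⟧) q, Finset.mem_range.2 (Nat.mod_lt _ (ordMod_pos hq _)), ?_⟩
    conv_rhs => rw [hi]
    rw [pow_eq_pow_iff_cast, Nat.cast_pow, Nat.cast_pow, order, ordMod, pow_mod_orderOf]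

noncomputable instance : Fintype (Orbits hq) := Fintype.ofFinite _

theorem sum_ordMod : ∑ x : Orbits hq, ordMod (order hq x) q = Nat.card Γ := by
  classical
  have := Fintype.ofFinite Γ
  rw [Nat.card_eq_fintype_card, ← Finset.card_univ,
    Finset.card_eq_sum_card_fiberwise (f := fun g : Γ => (⟦g⟧ : Orbits hq)) (t := Finset.univ)
      (fun _ _ => Finset.mem_coe.2 (Finset.mem_univ _))]
  exact Finset.sum_congr rfl fun x _ => (card_fiber hq x).symm

theorem card_order_eq_mul [DecidableEq (Orbits hq)] (d : ℕ) :
    (Finset.univ.filter fun x : Orbits hq => order hq x = d).card * ordMod d q =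
      Nat.card {g : Γ // orderOf g = d} := by
  classical
  have := Fintype.ofFinite Γ
  rw [Nat.card_eq_fintype_card, Fintype.card_subtype,
    Finset.card_eq_sum_card_fiberwise (f := fun g : Γ => (⟦g⟧ : Orbits hq))
      (t := Finset.univ.filter fun x : Orbits hq => order hq x = d),
    Finset.sum_congr rfl (g := fun _ => ordMod d q), Finset.sum_const, smul_eq_mul]
  · intro x hx
    rw [Finset.mem_filter] at hx
    rw [← hx.2, ← card_fiber hq x]
    congr 1
    ext g
    simp only [Finset.mem_filter, Finset.mem_univ, true_and, and_iff_right_iff_imp]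
    rintro rfl
    rw [order_mk]
  · intro g hg
    simpa [order_mk] using hg

variable {a : ℕ} (hu : u * u = q ^ a)

/-- The involution of the set of orbits induced by `x ↦ x ^ (-u)`. -/
def negPow (_hu : u * u = q ^ a) : Orbits hq → Orbits hq :=
  Quotient.map (fun x => (x ^ u)⁻¹) (by
    rintro x _ ⟨i, rfl⟩
    exact ⟨i, by rw [inv_pow, ← pow_mul, ← pow_mul, mul_comm]⟩)

/-- Applied twice it is `x ↦ x ^ (u * u) = x ^ q ^ a`, which stays in the orbit. -/
theorem negPow_involutive : Function.Involutive (negPow hq hu) := by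
  intro x
  induction x using Quotient.inductionOn with
  | h g =>
    refine (Quotient.sound (s := orbitSetoid hq) ⟨a, ?_⟩).symm
    change (((g ^ u)⁻¹) ^ u)⁻¹ = _
    rw [inv_pow, inv_inv, ← pow_mul, hu]

theorem order_negPow (x : Orbits hq) : order hq (negPow hq hu x) = order hq x := by
  induction x using Quotient.inductionOn with
  | h g =>
    refine (order_mk hq _).trans ?_
    rw [order_mk, orderOf_inv, Nat.Coprime.orderOf_pow (coprime_orderOf_of_sq hq hu g).symm]

theorem exists_of_negPow_eq {x y : Orbits hq} (h : negPow hq hu x = y) :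
    ∃ i : ℕ, y.out⁻¹ = x.out ^ (u * q ^ i) := by
  rw [← Quotient.out_eq x, ← Quotient.out_eq y] at h
  obtain ⟨i, hi⟩ := Quotient.exact h
  exact ⟨i, by rw [hi, inv_pow, inv_inv, pow_mul]⟩

theorem negPow_eq_self_iff {x : Orbits hq} :
    negPow hq hu x = x ↔ ∃ i : ℕ, order hq x ∣ u * q ^ i + 1 := by
  constructor
  · intro h
    obtain ⟨i, hi⟩ := exists_of_negPow_eq hq hu h
    exact ⟨i, by rw [order, orderOf_dvd_iff_pow_eq_one, pow_succ, ← hi, inv_mul_cancel]⟩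
  · rintro ⟨i, hi⟩
    rw [order, orderOf_dvd_iff_pow_eq_one, pow_succ, ← eq_inv_iff_mul_eq_one] at hi
    conv_lhs => rw [← Quotient.out_eq x]
    conv_rhs => rw [← Quotient.out_eq x]
    refine Quotient.sound (s := orbitSetoid hq) ⟨i, ?_⟩
    rw [inv_pow, ← pow_mul, hi, inv_inv]

theorem ordMod_dvd_card (hq : (Nat.card Γ).Coprime q) (d : ℕ) : ordMod d q ∣ Nat.card {g : Γ // orderOf g = d} := by
  classical exact ⟨_, (mul_comm _ _).trans (card_order_eq_mul hq d) |>.symm⟩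

/-- Without fixed orbits of order `d`, the involution pairs them off; the linear order merely
selects one from each pair. -/
theorem two_mul_card_lt [LinearOrder (Orbits hq)] {d : ℕ} (hd : ¬∃ i : ℕ, d ∣ u * q ^ i + 1) :
    2 * (Finset.univ.filter fun x : Orbits hq => order hq x = d ∧ x < negPow hq hu x).card =
      (Finset.univ.filter fun x : Orbits hq => order hq x = d).card := by
  have h1 : (Finset.univ.filter fun x : Orbits hq => order hq x = d ∧ x < negPow hq hu x).card =
      (Finset.univ.filter fun x : Orbits hq => order hq x = d ∧ negPow hq hu x < x).card := by
    have hinv := negPow_involutive hq hu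
    refine Finset.card_bij (fun x _ => negPow hq hu x) ?_ ?_ ?_
    · intro x hx
      simpa [order_negPow, hinv x] using hx
    · intro x _ y _ h
      exact hinv.injective h
    · intro x hx
      exact ⟨negPow hq hu x, by simpa [order_negPow, hinv x] using hx, hinv x⟩
  rw [two_mul]
  conv_lhs => rhs; rw [h1]
  rw [← Finset.card_union_of_disjoint]
  · congr 1
    ext x
    simp only [Finset.mem_union, Finset.mem_filter, Finset.mem_univ, true_and, ← and_or_left,
      and_iff_left_iff_imp]
    rintro rfl
    exact lt_or_gt_of_ne fun h => hd ((negPow_eq_self_iff hq hu).1 h.symm)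
  · rw [Finset.disjoint_filter]
    rintro x - ⟨-, h⟩ ⟨-, h'⟩
    exact lt_asymm h h'

theorem two_mul_ordMod_dvd_card (hq : (Nat.card Γ).Coprime q) {a : ℕ} (hu : u * u = q ^ a)
    {d : ℕ} (hd : ¬∃ i : ℕ, d ∣ u * q ^ i + 1) :
    2 * ordMod d q ∣ Nat.card {g : Γ // orderOf g = d} := by
  classical
  let := linearOrderOfSTO (WellOrderingRel : Orbits hq → Orbits hq → Prop)
  rw [← card_order_eq_mul hq, ← two_mul_card_lt hq hu hd]
  exact mul_dvd_mul_right (Dvd.intro _ rfl) _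

/-- A product over the orbits, collected according to the order of the elements. -/
theorem prod_orbits_eq [LinearOrder (Orbits hq)]
    [DecidablePred fun d => ∃ i : ℕ, d ∣ u * q ^ i + 1] {D : Finset ℕ} (hD : ∀ x : Orbits hq, order hq x ∈ D) (v w : ℕ → ℕ) :
    (∏ x : {x : Orbits hq // negPow hq hu x = x}, v (order hq x)) *
        ∏ x : {x : Orbits hq // x < negPow hq hu x}, w (order hq x) =
      ∏ d ∈ D, if ∃ i : ℕ, d ∣ u * q ^ i + 1
        then v d ^ (Nat.card {g : Γ // orderOf g = d} / ordMod d q)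
        else w d ^ (Nat.card {g : Γ // orderOf g = d} / (2 * ordMod d q)) := by
  have h1 : ∏ x : {x : Orbits hq // negPow hq hu x = x}, v (order hq x) =
      ∏ x with negPow hq hu x = x, v (order hq x) :=
    (Finset.prod_subtype _ (by simp) fun x => v (order hq x)).symm
  have h2 : ∏ x : {x : Orbits hq // x < negPow hq hu x}, w (order hq x) =
      ∏ x with x < negPow hq hu x, w (order hq x) :=
    (Finset.prod_subtype _ (by simp) fun x => w (order hq x)).symm
  rw [h1, h2, ← Finset.prod_fiberwise_of_maps_to (t := D) (g := order hq) (fun x _ => hD x),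
    ← Finset.prod_fiberwise_of_maps_to (t := D) (g := order hq) (fun x _ => hD x),
    ← Finset.prod_mul_distrib]
  refine Finset.prod_congr rfl fun d _ => ?_
  have hconst : ∀ (s : Finset (Orbits hq)) (f : ℕ → ℕ),
      ∏ x ∈ s with order hq x = d, f (order hq x) = f d ^ (s.filter fun x => order hq x = d).card :=
    fun s f => Finset.prod_eq_pow_card fun x hx => by rw [(Finset.mem_filter.1 hx).2]
  rw [hconst, hconst, Finset.filter_filter, Finset.filter_filter]
  have hcard := card_order_eq_mul hq d
  split_ifs with hd
  · have e1 : (Finset.univ.filter fun x : Orbits hq => negPow hq hu x = x ∧ order hq x = d) =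
        Finset.univ.filter fun x : Orbits hq => order hq x = d := by
      ext x
      simp only [Finset.mem_filter, Finset.mem_univ, true_and, and_iff_right_iff_imp]
      rintro rfl
      exact (negPow_eq_self_iff hq hu).2 hd
    have e2 : (Finset.univ.filter fun x : Orbits hq => x < negPow hq hu x ∧ order hq x = d) = ∅ := by
      ext x
      simp only [Finset.mem_filter, Finset.mem_univ, true_and, Finset.notMem_empty, iff_false]
      rintro ⟨h, rfl⟩
      exact h.ne' ((negPow_eq_self_iff hq hu).2 hd)
    rw [e1, e2, Finset.card_empty, pow_zero, mul_one, ← hcard]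
    -- Cancelling `ordMod d q` requires it to be positive, which an orbit of order `d` guarantees;
    -- without one both exponents are `0`.
    rcases (Finset.univ.filter fun x : Orbits hq => order hq x = d).eq_empty_or_nonempty
      with h | ⟨x, hx⟩
    · rw [h, Finset.card_empty, zero_mul, Nat.zero_div]
    · rw [Finset.mem_filter] at hx
      rw [Nat.mul_div_cancel _ (hx.2 ▸ ordMod_pos hq x.out)]
  · have e1 : (Finset.univ.filter fun x : Orbits hq => negPow hq hu x = x ∧ order hq x = d) = ∅ := by
      ext x
      simp only [Finset.mem_filter, Finset.mem_univ, true_and, Finset.notMem_empty, iff_false]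
      rintro ⟨h, rfl⟩
      exact hd ((negPow_eq_self_iff hq hu).1 h)
    have e2 := two_mul_card_lt hq hu hd
    simp only [and_comm] at e2
    rw [e1, Finset.card_empty, pow_zero, one_mul, ← hcard, ← e2]
    rcases (Finset.univ.filter fun x : Orbits hq => x < negPow hq hu x ∧ order hq x = d).eq_empty_or_nonempty
      with h | ⟨x, hx⟩
    · rw [h, Finset.card_empty, mul_zero, zero_mul, Nat.zero_div]
    · rw [Finset.mem_filter] at hx
      rw [mul_right_comm, mul_comm, Nat.mul_div_cancel _
        (mul_pos two_pos (hx.2.2 ▸ ordMod_pos hq x.out))]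

end PowOrbit

/-! ### Characters in characteristic `p` -/

/-- The group of characters of `A` with values in an algebraic closure of `𝔽_p`. -/
abbrev DualGroup (p : ℕ) [Fact p.Prime] (A : Type*) [AddCommGroup A] : Type _ :=
  Multiplicative A →* (AlgebraicClosure (ZMod p))ˣ

namespace DualGroup

variable {p : ℕ} [Fact p.Prime] {A : Type*} [AddCommGroup A]

theorem hasEnoughRootsOfUnity (hA : ¬p ∣ AddMonoid.exponent A) :
    HasEnoughRootsOfUnity (AlgebraicClosure (ZMod p)) (Monoid.exponent (Multiplicative A)) := by
  have : NeZero ((Monoid.exponent (Multiplicative A) : ℕ) : AlgebraicClosure (ZMod p)) :=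
    ⟨fun h => hA (by
      rw [CharP.cast_eq_zero_iff (AlgebraicClosure (ZMod p)) p] at h
      rwa [← Monoid.exponent_multiplicative])⟩
  infer_instance

theorem orderOf_dvd_exponent (χ : DualGroup p A) : orderOf χ ∣ AddMonoid.exponent A := by
  refine orderOf_dvd_of_pow_eq_one (MonoidHom.ext fun a => ?_)
  rw [MonoidHom.pow_apply, ← map_pow, ← Monoid.exponent_multiplicative,
    Monoid.pow_exponent_eq_one, map_one, MonoidHom.one_apply]

variable [Fintype A]

theorem nonempty_mulEquiv (hA : ¬p ∣ AddMonoid.exponent A) :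
    Nonempty (DualGroup p A ≃* Multiplicative A) := by
  have := hasEnoughRootsOfUnity hA
  exact CommGroup.monoidHom_mulEquiv_of_hasEnoughRootsOfUnity _ _

theorem card_eq (hA : ¬p ∣ AddMonoid.exponent A) : Nat.card (DualGroup p A) = Nat.card A :=
  Nat.card_congr ((nonempty_mulEquiv hA).some.toEquiv.trans Multiplicative.toAdd)

theorem not_dvd_card (hA : ¬p ∣ AddMonoid.exponent A) : ¬p ∣ Nat.card A := by
  intro h
  obtain ⟨a, ha⟩ := exists_prime_addOrderOf_dvd_card' p h
  exact hA (ha ▸ AddMonoid.addOrder_dvd_exponent a)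

theorem card_coprime (hA : ¬p ∣ AddMonoid.exponent A) (s : ℕ) :
    (Nat.card (DualGroup p A)).Coprime (p ^ s) := by
  rw [card_eq hA]
  exact (((Fact.out : p.Prime).coprime_iff_not_dvd.2 (not_dvd_card hA)).pow_left s).symm

theorem card_orderOf_eq (hA : ¬p ∣ AddMonoid.exponent A) (d : ℕ) :
    Nat.card {χ : DualGroup p A // orderOf χ = d} = numOrder A d := by
  obtain ⟨e⟩ := nonempty_mulEquiv hA
  refine Nat.card_congr ((e.toEquiv.trans Multiplicative.toAdd).subtypeEquiv fun χ => ?_)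
  rw [← e.orderOf_eq]
  rfl

theorem sum_apply_eq_zero [Fintype (DualGroup p A)] (hA : ¬p ∣ AddMonoid.exponent A)
    {c : Multiplicative A} (hc : c ≠ 1) :
    ∑ χ : DualGroup p A, (χ c : AlgebraicClosure (ZMod p)) = 0 := by
  have := hasEnoughRootsOfUnity hA
  obtain ⟨ψ, hψ⟩ := CommGroup.exists_apply_ne_one_of_hasEnoughRootsOfUnity (Multiplicative A)
    (AlgebraicClosure (ZMod p)) hc
  have h := Equiv.sum_comp (Equiv.mulLeft ψ)
    fun χ : DualGroup p A => (χ c : AlgebraicClosure (ZMod p))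
  simp only [Equiv.coe_mulLeft, MonoidHom.mul_apply, Units.val_mul, ← Finset.mul_sum] at h
  by_contra h0
  exact hψ (Units.ext (mul_right_cancel₀ h0 (h.trans (one_mul _).symm)))

/-- Fourier inversion: by orthogonality of characters the hypothesis gives `|A| * w b = 0`, and
`|A|` is invertible modulo `p`. -/
theorem eq_zero_of_sum_eq_zero (hA : ¬p ∣ AddMonoid.exponent A)
    {w : A → AlgebraicClosure (ZMod p)}
    (hw : ∀ χ : DualGroup p A, ∑ a, w a * χ (.ofAdd a) = 0) (b : A) : w b = 0 := by
  classical
  have := Fintype.ofFinite (DualGroup p A)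
  have h : ∑ χ : DualGroup p A, (∑ a, w a * χ (.ofAdd a)) * χ (.ofAdd (-b)) = 0 :=
    Finset.sum_eq_zero fun χ _ => by rw [hw, zero_mul]
  simp only [Finset.sum_mul] at h
  rw [Finset.sum_comm, Finset.sum_eq_single b] at h
  · simp only [mul_assoc, ← Units.val_mul, ← map_mul, ← ofAdd_add, add_neg_cancel, ofAdd_zero,
      map_one, Units.val_one, mul_one, Finset.sum_const, Finset.card_univ, nsmul_eq_mul,
      mul_eq_zero] at h
    refine h.resolve_left fun h0 => not_dvd_card hA ?_
    rw [CharP.cast_eq_zero_iff (AlgebraicClosure (ZMod p)) p] at h0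
    rwa [← card_eq hA, Nat.card_eq_fintype_card]
  · intro a _ hab
    simp only [mul_assoc, ← Units.val_mul, ← map_mul, ← ofAdd_add]
    rw [← Finset.mul_sum, sum_apply_eq_zero hA, mul_zero]
    rw [ne_eq, ofAdd_eq_one, ← sub_eq_add_neg, sub_eq_zero]
    exact hab
  · exact fun h => absurd (Finset.mem_univ _) h

end DualGroup

/-! ### The components of the group ring -/

section Component

variable {R R' : Type*} [CommRing R] [CommRing R'] {A P : Type*} [AddCommGroup A] [AddCommGroup P]

/-- The homomorphism `R[A × P] → R'[P]` induced by a ring homomorphism `R → R'` and a character of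
`A` with values in `R'`. -/
noncomputable def componentHom (P : Type*) [AddCommGroup P] (j : R →+* R')
    (t : Multiplicative A →* R') : R[A × P] →+* R'[P] :=
  AddMonoidAlgebra.liftNCRingHom (AddMonoidAlgebra.singleZeroRingHom.comp j)
    { toFun := fun x => AddMonoidAlgebra.single x.toAdd.2 (t (.ofAdd x.toAdd.1))
      map_one' := by simp [AddMonoidAlgebra.one_def]
      map_mul' := fun x y => by simp [AddMonoidAlgebra.single_mul_single] }
    fun _ _ => Commute.all _ _

theorem componentHom_single (j : R →+* R') (t : Multiplicative A →* R') (a : A) (g : P) (c : R) :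
    componentHom P j t (AddMonoidAlgebra.single (a, g) c) =
      AddMonoidAlgebra.single g (j c * t (.ofAdd a)) := by
  rw [componentHom, AddMonoidAlgebra.liftNCRingHom_single]
  simp [AddMonoidAlgebra.single_mul_single]

theorem coeff_componentHom [Fintype A] (j : R →+* R') (t : Multiplicative A →* R') (u : R[A × P])
    (g : P) : (componentHom P j t u).coeff g = ∑ a, j (u.coeff (a, g)) * t (.ofAdd a) := by
  classical
  induction u using AddMonoidAlgebra.induction_linear with
  | zero => simp
  | add u v hu hv => simp [hu, hv, add_mul, Finset.sum_add_distrib]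
  | single x c =>
    obtain ⟨b, h⟩ := x
    rw [componentHom_single, AddMonoidAlgebra.coeff_single, AddMonoidAlgebra.coeff_single,
      Finset.sum_eq_single b]
    · by_cases hg : h = g
      · subst hg; simp
      · simp [hg]
    · intro a _ hab
      simp [hab.symm]
    · exact fun h => absurd (Finset.mem_univ _) h

theorem twist_single {G : Type*} [AddCommGroup G] (c : R →+* R') (g : G) (x : R) :
    twist G c (AddMonoidAlgebra.single g x) = AddMonoidAlgebra.single (-g) (c x) := by
  simp [twist]

end Component

namespace GR

variable {p : ℕ} [Fact p.Prime] {r n : ℕ} [NeZero r] [NeZero n]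

/-- The Teichmüller lift of a character. -/
theorem exists_character_lift {A : Type*} [AddCommGroup A] {χ : DualGroup p A}
    (hχ : χ ^ p ^ n = χ) : ∃ t : Multiplicative A →* GR p r n,
      (∀ a, t a ^ p ^ n = t a) ∧ ∀ a, residue p r n (t a) = χ a := by
  have h : ∀ a, (χ a : AlgebraicClosure (ZMod p)) ^ p ^ n = χ a := fun a => by
    rw [← Units.val_pow_eq_pow_val, ← MonoidHom.pow_apply, hχ]
  choose t ht1 ht2 using fun a => exists_teichmuller_residue_eq (r := r) (h a)
  have hn := NeZero.ne n
  -- Lifts chosen value by value are automatically multiplicative, since Teichmüller elements are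
  -- closed under products and determined by residues.
  refine ⟨⟨⟨t, ?_⟩, fun a b => ?_⟩, ht1, ht2⟩
  · exact eq_of_pow_eq_of_residue_eq hn hn (ht1 _) (one_pow _) (by simp [ht2])
  · refine eq_of_pow_eq_of_residue_eq hn hn (ht1 _) ?_ (by simp [ht2])
    change (t a * t b) ^ p ^ n = t a * t b
    rw [mul_pow, ht1, ht1]

end GR

/-! ### Decomposition of the group ring and of its self-dual codes -/

theorem AddMonoidAlgebra.natCard_eq (R G : Type*) [Semiring R] [Finite G] :
    Nat.card R[G] = Nat.card R ^ Nat.card G := by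
  rw [← Nat.card_fun]
  exact Nat.card_congr (AddMonoidAlgebra.coeffEquiv.trans Finsupp.equivFunOnFinite)

namespace GR

variable {p : ℕ} [Fact p.Prime] {r s : ℕ} [NeZero r] [NeZero s]

theorem residue_pow_card_pow (z : GR p r s) (i : ℕ) :
    residue p r s z ^ p ^ (s * i) = residue p r s z := by
  induction i with
  | zero => simp
  | succ i ih => rw [mul_add, mul_one, pow_add, pow_mul, ih, pow_card_of_ringHom]

end GR

section Decomposition

open PowOrbit GR

variable {p : ℕ} [Fact p.Prime] {r s : ℕ} {A : Type*} [AddCommGroup A]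
  [Finite (DualGroup p A)] (hq : (Nat.card (DualGroup p A)).Coprime (p ^ s))

instance (x : Orbits hq) : NeZero (ordMod (order hq x) (p ^ s)) := ⟨(ordMod_pos hq x.out).ne'⟩

theorem out_pow_eq (x : Orbits hq) :
    x.out ^ p ^ (s * ordMod (order hq x) (p ^ s)) = x.out := by
  rw [pow_mul]
  exact (pow_pow_eq_self_iff _).2 dvd_rfl

variable [NeZero r] [NeZero s] {c a : ℕ} (hu : p ^ c * p ^ c = (p ^ s) ^ a)

/-- The same exponent `c + s * i` relates the two characters and defines the Frobenius lift on
coefficients; this match lets the twist pass to components. -/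
theorem exists_component_conj {x y : Orbits hq} (h : negPow hq hu x = y) :
    ∃ i : ℕ, y.out⁻¹ = x.out ^ p ^ (c + s * i) ∧
      ∃ ε : GR p r (s * ordMod (order hq x) (p ^ s)) →+* GR p r (s * ordMod (order hq y) (p ^ s)),
        ∀ z, residue p r _ (ε z) = residue p r _ z ^ p ^ (c + s * i) := by
  obtain ⟨i, hi⟩ := exists_of_negPow_eq hq hu h
  refine ⟨i, by rw [hi, pow_add, pow_mul p s i], ?_⟩
  refine exists_lift ((iterateFrobenius (AlgebraicClosure (ZMod p)) p (c + s * i)).comp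
    (residue p r _)) ?_
  rw [← h, order_negPow]

variable {P : Type*} [AddCommGroup P]

variable {j : ∀ x : Orbits hq, GR p r s →+* GR p r (s * ordMod (order hq x) (p ^ s))}
  {t : ∀ x : Orbits hq, Multiplicative A →* GR p r (s * ordMod (order hq x) (p ^ s))}

/-- It suffices to compare monomials. On coefficients from `GR p r s` the extra `s * i` Frobenius
steps are invisible; on character values `hi` supplies the inverse. Both identities hold on residues
and lift by rigidity. -/
theorem twist_componentHom {x y : Orbits hq} {i : ℕ} (hi : y.out⁻¹ = x.out ^ p ^ (c + s * i))
    {ε : GR p r (s * ordMod (order hq x) (p ^ s)) →+* GR p r (s * ordMod (order hq y) (p ^ s))}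
    (hε : ∀ z, residue p r _ (ε z) = residue p r _ z ^ p ^ (c + s * i))
    {σ : GR p r s →+* GR p r s} (hσ : ∀ z, residue p r s (σ z) = residue p r s z ^ p ^ c)
    (hj : ∀ x z, residue p r _ (j x z) = residue p r s z)
    (ht : ∀ x a, residue p r _ (t x a) = x.out a)
    (ht' : ∀ x a, t x a ^ p ^ (s * ordMod (order hq x) (p ^ s)) = t x a) (u : (GR p r s)[A × P]) :
    twist P ε (componentHom P (j x) (t x) u) =
      componentHom P (j y) (t y) (twist (A × P) σ u) := by
  have h1 : ε.comp (j x) = (j y).comp σ := ringHom_ext_residue fun z => by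
    rw [RingHom.comp_apply, RingHom.comp_apply, hε, hj, hj, hσ, add_comm, pow_add, pow_mul,
      residue_pow_card_pow]
  have h2 : ∀ a : A, ε (t x (.ofAdd a)) = t y (.ofAdd (-a)) := by
    intro a
    refine eq_of_pow_eq_of_residue_eq (NeZero.ne (s * ordMod (order hq x) (p ^ s)))
      (NeZero.ne (s * ordMod (order hq y) (p ^ s))) ?_ (ht' y _) ?_
    · rw [← map_pow, ht']
    · rw [hε, ht, ht, ofAdd_neg, map_inv, ← MonoidHom.inv_apply, hi, MonoidHom.pow_apply,
        Units.val_pow_eq_pow_val]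
  induction u using AddMonoidAlgebra.induction_linear with
  | zero => simp
  | add u v hu hv => rw [map_add, map_add, hu, hv, map_add, map_add]
  | single b z =>
    obtain ⟨b, g⟩ := b
    rw [componentHom_single, twist_single, twist_single, Prod.neg_mk, componentHom_single,
      map_mul, h2, ← RingHom.comp_apply, h1, RingHom.comp_apply]

variable [Fintype A]

/-- Applying Frobenius `s * i` times fixes the residues of the coefficients and moves the
representative of an orbit to any of its characters, so Fourier inversion applies. -/
theorem residue_coeff_eq_zero {P : Type*} (hA : ¬p ∣ AddMonoid.exponent A)
    {u : (GR p r s)[A × P]}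
    (h : ∀ (x : Orbits hq) g, ∑ a, residue p r s (u.coeff (a, g)) * x.out (.ofAdd a) = 0)
    (b : A × P) : residue p r s (u.coeff b) = 0 := by
  obtain ⟨b, g⟩ := b
  refine DualGroup.eq_zero_of_sum_eq_zero hA (w := fun a => residue p r s (u.coeff (a, g)))
    (fun χ => ?_) b
  obtain ⟨i, hi⟩ := exists_eq_out_pow hq χ
  have h1 := congrArg (iterateFrobenius (AlgebraicClosure (ZMod p)) p (s * i)) (h ⟦χ⟧ g)
  rw [map_sum, map_zero] at h1
  rw [← h1]
  refine Finset.sum_congr rfl fun a _ => ?_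
  rw [map_mul, iterateFrobenius_def, iterateFrobenius_def, residue_pow_card_pow]
  conv_lhs => rw [hi]
  rw [MonoidHom.pow_apply, Units.val_pow_eq_pow_val, pow_mul]

variable [Fintype P]

/-- If all components of `u = p ^ i • v` vanish and `i < r`, those of `v` vanish modulo `p`, so `p`
divides `v`. Repeating this reaches `p ^ r = 0`. -/
theorem componentHom_injective (hA : ¬p ∣ AddMonoid.exponent A)
    (hj : ∀ x z, residue p r _ (j x z) = residue p r s z)
    (ht : ∀ x a, residue p r _ (t x a) = x.out a) :
    Function.Injective fun (u : (GR p r s)[A × P]) (x : Orbits hq) =>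
      componentHom P (j x) (t x) u := by
  refine (injective_iff_map_eq_zero (RingHom.pi fun x => componentHom P (j x) (t x))).2
    fun u hu => ?_
  have key : ∀ i ≤ r, ∃ v, u = (p ^ i) • v := by
    intro i
    induction i with
    | zero => exact fun _ => ⟨u, by simp⟩
    | succ i ih =>
      intro hi
      obtain ⟨v, hv⟩ := ih (by omega)
      have h0 : ∀ b, residue p r s (v.coeff b) = 0 := by
        refine residue_coeff_eq_zero hq hA fun x g => ?_
        have h1 : componentHom P (j x) (t x) u = 0 := congrFun hu x
        rw [hv, map_nsmul] at h1
        have h2 : (p ^ i) • (componentHom P (j x) (t x) v).coeff g = 0 :=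
          congrArg (fun w => w.coeff g) h1
        rw [nsmul_eq_mul, Nat.cast_pow] at h2
        have h3 := pow_dvd_of_pow_mul_eq_zero (Nat.add_sub_cancel' (by omega : i ≤ r)) h2
        have h4 := residue_eq_zero.2 ((dvd_pow_self _ (by omega)).trans h3)
        rw [coeff_componentHom, map_sum] at h4
        simpa only [map_mul, hj, ht] using h4
      choose w hw using fun b => residue_eq_zero.1 (h0 b)
      refine ⟨.ofCoeff (Finsupp.equivFunOnFinite.symm w), ?_⟩
      rw [hv, pow_succ, mul_smul]
      congr 1
      ext b
      rw [AddMonoidAlgebra.coeff_smul, Finsupp.smul_apply, hw, nsmul_eq_mul]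
      rfl
  obtain ⟨v, hv⟩ := key r le_rfl
  rw [hv]
  ext b
  rw [AddMonoidAlgebra.coeff_smul, Finsupp.smul_apply, nsmul_eq_mul, Nat.cast_pow,
    natCast_pow_eq_zero, zero_mul]
  rfl

/-- Surjectivity follows by counting: the orbit lengths sum to `|A|`, so both sides have equal
cardinality. -/
theorem componentHom_bijective (hA : ¬p ∣ AddMonoid.exponent A)
    (hj : ∀ x z, residue p r _ (j x z) = residue p r s z)
    (ht : ∀ x a, residue p r _ (t x a) = x.out a) :
    Function.Bijective fun (u : (GR p r s)[A × P]) (x : Orbits hq) =>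
      componentHom P (j x) (t x) u := by
  have hfin : ∀ n, Finite (GR p r n)[P] := fun n =>
    Finite.of_equiv _ (AddMonoidAlgebra.coeffEquiv.trans Finsupp.equivFunOnFinite).symm
  refine (componentHom_injective hq hA hj ht).bijective_of_nat_card_le (le_of_eq ?_)
  simp only [Nat.card_pi, AddMonoidAlgebra.natCard_eq, GR.card, Nat.card_prod]
  rw [Finset.prod_pow, Finset.prod_pow_eq_pow_sum, ← Finset.mul_sum, ← Finset.mul_sum,
    sum_ordMod, DualGroup.card_eq hA, ← pow_mul, ← pow_mul]
  congr 1
  ring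

/-- Common to both forms, with `c = 0` or `c = s / 2`; `v` stands for the count on a fixed
component, where the twist is some Frobenius lift. -/
theorem selfDualCard_twist_eq_prod (hA : ¬p ∣ AddMonoid.exponent A)
    {σ : GR p r s →+* GR p r s} (hσ : ∀ z, residue p r s (σ z) = residue p r s z ^ p ^ c)
    [LinearOrder (Orbits hq)] {v : Orbits hq → ℕ}
    (hv : ∀ (x : Orbits hq) (i : ℕ), order hq x ∣ p ^ c * (p ^ s) ^ i + 1 →
      ∀ ε : GR p r (s * ordMod (order hq x) (p ^ s)) →+* GR p r (s * ordMod (order hq x) (p ^ s)),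
        (∀ z, residue p r _ (ε z) = residue p r _ z ^ p ^ (c + s * i)) →
          selfDualCard (twist P ε) = v x) :
    selfDualCard (twist (A × P) σ) =
      (∏ x : {x : Orbits hq // negPow hq hu x = x}, v x) *
        ∏ x : {x : Orbits hq // x < negPow hq hu x},
          NA p r (s * ordMod (order hq x.1) (p ^ s)) P := by
  choose j hj using fun x : Orbits hq =>
    exists_lift (residue p r s) (Dvd.intro (ordMod (order hq x) (p ^ s)) rfl)
  choose t ht' ht using fun x : Orbits hq => exists_character_lift (r := r) (out_pow_eq hq x)
  choose i hi ε hε using fun (x y : Orbits hq) (h : negPow hq hu x = y) =>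
    exists_component_conj (r := r) hq hu h
  have hσ2 : ∀ z, σ (σ z) = z := by
    have : σ.comp σ = RingHom.id _ := ringHom_ext_residue fun z => by
      rw [RingHom.comp_apply, hσ, hσ, ← pow_mul, hu, ← pow_mul p s a, residue_pow_card_pow]
      rfl
    exact fun z => congrArg (fun f => f z) this
  rw [selfDualCard_eq_prod (negPow_involutive hq hu)
    (B := fun x => (GR p r (s * ordMod (order hq x) (p ^ s)))[P])
    (fun x J => annihilator_annihilator J) (fun x => componentHom P (j x) (t x))
    (componentHom_bijective hq hA hj ht) (twist_twist hσ2) (fun x y h => twist P (ε x y h))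
    (fun x y h u => twist_componentHom hq (hi x y h) (hε x y h) hσ hj ht ht' u)]
  congr 1
  refine Finset.prod_congr rfl fun x _ => hv x (i x x x.2) ?_ _ (hε x x x.2)
  rw [order, orderOf_dvd_iff_pow_eq_one, pow_succ, ← pow_mul p s, ← pow_add, ← hi x x x.2]
  exact inv_mul_cancel (G := DualGroup p A) _

end Decomposition

/-! ### Good pairs and the main theorem -/

/-- Goodness excludes the exponent `0`; adding `d.totient` preserves `q ^ i` modulo `d` and makes
the exponent positive. -/
theorem isGood_iff {d q : ℕ} (hd : 0 < d) (hq : q.Coprime d) :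
    IsGood d q ↔ ∃ i : ℕ, d ∣ q ^ i + 1 := by
  constructor
  · rintro (⟨t, -, -, h⟩ | ⟨t, -, -, h⟩) <;> exact ⟨t, h⟩
  · rintro ⟨i, hi⟩
    have h : d ∣ q ^ (i + d.totient) + 1 := by
      rw [← Nat.modEq_zero_iff_dvd] at hi ⊢
      have h1 := (Nat.ModEq.pow_totient hq).mul_left (q ^ i)
      rw [← pow_add, mul_one] at h1
      exact (h1.add_right 1).trans hi
    have hpos := Nat.totient_pos.2 hd
    rcases Nat.even_or_odd (i + d.totient) with he | ho
    · refine Or.inr ⟨_, ?_, he, h⟩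
      obtain ⟨k, hk⟩ := he
      omega
    · exact Or.inl ⟨_, by omega, ho, h⟩

theorem oddlyGood_sq_iff {d Q q : ℕ} (h : Q * Q = q) :
    OddlyGood d Q ↔ ∃ i : ℕ, d ∣ Q * q ^ i + 1 := by
  have e : ∀ i, Q * q ^ i = Q ^ (2 * i + 1) := fun i => by
    rw [← h, ← pow_two, ← pow_mul, pow_succ, mul_comm]
  constructor
  · rintro ⟨t, -, ⟨i, rfl⟩, ht⟩
    exact ⟨i, by rwa [e]⟩
  · rintro ⟨i, hi⟩
    exact ⟨2 * i + 1, by omega, ⟨i, rfl⟩, by rwa [← e]⟩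

theorem natCast_pow_eq_neg_one {d q i : ℕ} (h : d ∣ q ^ i + 1) : (q : ZMod d) ^ i = -1 := by
  rw [← ZMod.natCast_eq_zero_iff] at h
  push_cast at h
  exact eq_neg_of_add_eq_zero_left h

/-- If `-1` is a power of `q` modulo `d`, the exponent is an odd multiple of half the order. -/
theorem exists_eq_half_ordMod_add {d q i : ℕ} (hq : q.Coprime d) (h : d ∣ q ^ i + 1)
    (hk : ordMod d q ≠ 1) : 2 ∣ ordMod d q ∧ ∃ e, i = ordMod d q / 2 + ordMod d q * e := by
  have h1 := natCast_pow_eq_neg_one h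
  have h2 : ordMod d q ∣ i * 2 := by
    rw [ordMod, orderOf_dvd_iff_pow_eq_one, pow_mul, h1, neg_one_sq]
  -- Otherwise `-1 = 1` modulo `d`, so `d ∣ 2` and `q ≡ 1`, contradicting `hk`.
  have h3 : ¬ordMod d q ∣ i := by
    intro hdvd
    rw [ordMod, orderOf_dvd_iff_pow_eq_one, h1] at hdvd
    have hd2 : d ∣ 2 := by
      rw [← ZMod.natCast_eq_zero_iff]
      push_cast
      rw [← one_add_one_eq_two]
      nth_rewrite 1 [← hdvd]
      exact neg_add_cancel 1
    apply hk
    rw [ordMod, orderOf_eq_one_iff]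
    rcases (Nat.dvd_prime Nat.prime_two).1 hd2 with rfl | rfl
    · exact Subsingleton.elim _ _
    · rw [← ZMod.natCast_mod q 2, Nat.odd_iff.1 (Nat.coprime_two_right.1 hq), Nat.cast_one]
  obtain ⟨m, hm⟩ := h2
  rcases Nat.even_or_odd' m with ⟨e, rfl | rfl⟩
  · exact absurd ⟨e, by linarith⟩ h3
  · have hke : Even (ordMod d q) := by
      have : Even (ordMod d q * (2 * e + 1)) := ⟨i, by linarith⟩
      exact (Nat.even_mul.1 this).resolve_right (by simp)
    obtain ⟨k, hk2⟩ := hke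
    rw [hk2] at hm ⊢
    refine ⟨⟨k, by ring⟩, e, ?_⟩
    rw [← two_mul, Nat.mul_div_cancel_left _ two_pos]
    linarith

/-- Here `Q ^ (2 * i + 1) = -1`; squaring shows that the order of `q` divides `2 * i + 1`, and the
quotient of an odd number is odd. -/
theorem exists_eq_ordMod_mul {d Q q i : ℕ} (hQ : Q * Q = q) (h : d ∣ Q * q ^ i + 1) :
    ∃ e, 2 * i + 1 = ordMod d q * (2 * e + 1) := by
  have e1 : Q * q ^ i = Q ^ (2 * i + 1) := by
    rw [← hQ, ← pow_two, ← pow_mul, pow_succ, mul_comm]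
  rw [e1] at h
  have h1 := natCast_pow_eq_neg_one h
  have h2 : ordMod d q ∣ 2 * i + 1 := by
    rw [ordMod, orderOf_dvd_iff_pow_eq_one, ← hQ, ← pow_two, Nat.cast_pow, ← pow_mul, mul_comm,
      pow_mul, h1, neg_one_sq]
  obtain ⟨m, hm⟩ := h2
  have hodd : Odd (ordMod d q * m) := ⟨i, hm.symm⟩
  obtain ⟨e, he⟩ := (Nat.odd_mul.1 hodd).2
  exact ⟨e, by rw [hm, he]⟩

/-- The Frobenius exponent equals half the component degree `s * k` plus full periods, so it induces
the conjugation. -/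
theorem half_add_mul_eq {s i k e : ℕ} (hs : Even s) (h : 2 * i + 1 = k * (2 * e + 1)) :
    s / 2 + s * i = s * k / 2 + s * k * e := by
  obtain ⟨m, rfl⟩ := hs
  rw [← two_mul, mul_assoc 2 m k, Nat.mul_div_cancel_left _ two_pos,
    Nat.mul_div_cancel_left _ two_pos]
  calc m + 2 * m * i = m * (2 * i + 1) := by ring
    _ = m * k + 2 * (m * k) * e := by rw [h]; ring

section

open GR

variable {p : ℕ} [Fact p.Prime] {r n : ℕ} [NeZero r] [NeZero n] {P : Type*} [AddCommGroup P]
  [Fintype P] {ε : GR p r n →+* GR p r n}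

theorem selfDualCard_twist_eq_NEA {e : ℕ}
    (hε : ∀ z, residue p r n (ε z) = residue p r n z ^ p ^ (n * e)) :
    selfDualCard (twist P ε) = NEA p r n P := by
  have : ε = RingHom.id _ := ringHom_ext_residue fun z => by
    rw [hε, residue_pow_card_pow]; rfl
  rw [this, NEA_eq_selfDualCard]

theorem selfDualCard_twist_eq_NHA {e : ℕ}
    (hε : ∀ z, residue p r n (ε z) = residue p r n z ^ p ^ (n / 2 + n * e)) :
    selfDualCard (twist P ε) = NHA p r n P := by
  refine (NHA_eq_selfDualCard p r n (conjGR_eq_of_residue fun z => ?_)).symm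
  rw [hε, add_comm, pow_add, pow_mul, residue_pow_card_pow]

end

open PowOrbit GR in
/-- The divisibilities say that all exponents are integers, i.e. that the divisions of natural
numbers in them are exact. -/
theorem mainTheorem1 (p : ℕ) [Fact p.Prime] (r s : ℕ) (hr : 1 ≤ r) (hs : 1 ≤ s)
    (A : Type*) [AddCommGroup A] [Fintype A] (P : Type*) [AddCommGroup P] [Fintype P]
    (M : ℕ) (hM : M = AddMonoid.exponent A) (hpM : ¬ p ∣ M)
    (hP : IsPGroup p (Multiplicative P)) :
    ((∀ d ∈ M.divisors, ordMod d (p ^ s) ∣ numOrder A d ∧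
        2 * ordMod d (p ^ s) ∣ chi d (p ^ s) * numOrder A d) ∧
      NEA p r s (A × P) =
        NEA p r s P ^
            (∑ d ∈ M.divisors with ordMod d (p ^ s) = 1, (1 - chi d (p ^ s)) * numOrder A d) *
          (∏ d ∈ M.divisors with ordMod d (p ^ s) ≠ 1,
            NHA p r (s * ordMod d (p ^ s)) P ^
              ((1 - chi d (p ^ s)) * (numOrder A d / ordMod d (p ^ s)))) *
          ∏ d ∈ M.divisors,
            NA p r (s * ordMod d (p ^ s)) P ^
              (chi d (p ^ s) * numOrder A d / (2 * ordMod d (p ^ s)))) ∧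
    (Even s →
      (∀ d ∈ M.divisors, 2 * ordMod d (p ^ s) ∣ lam d (p ^ (s / 2)) * numOrder A d) ∧
      NHA p r s (A × P) =
        (∏ d ∈ M.divisors,
            NHA p r (s * ordMod d (p ^ s)) P ^
              ((1 - lam d (p ^ (s / 2))) * (numOrder A d / ordMod d (p ^ s)))) *
          ∏ d ∈ M.divisors,
            NA p r (s * ordMod d (p ^ s)) P ^
              (lam d (p ^ (s / 2)) * numOrder A d / (2 * ordMod d (p ^ s)))) := by
  classical
  subst hM
  have : NeZero r := ⟨by omega⟩
  have : NeZero s := ⟨by omega⟩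
  have : Finite (DualGroup p A) := Finite.of_equiv _ (DualGroup.nonempty_mulEquiv hpM).some.symm.toEquiv
  have hq := DualGroup.card_coprime hpM s
  let := linearOrderOfSTO (WellOrderingRel : Orbits hq → Orbits hq → Prop)
  have hN := DualGroup.card_orderOf_eq hpM
  have hM0 : AddMonoid.exponent A ≠ 0 := fun h => hpM (h ▸ dvd_zero p)
  have hD : ∀ x : Orbits hq, order hq x ∈ (AddMonoid.exponent A).divisors := fun x =>
    Nat.mem_divisors.2 ⟨DualGroup.orderOf_dvd_exponent _, hM0⟩
  have hcop : ∀ d ∈ (AddMonoid.exponent A).divisors, (p ^ s).Coprime d := fun d hd =>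
    ((Fact.out : p.Prime).coprime_iff_not_dvd.2
      fun h => hpM (h.trans (Nat.dvd_of_mem_divisors hd))).pow_left s
  constructor
  · have hu : p ^ 0 * p ^ 0 = (p ^ s) ^ 0 := by simp
    have hgood : ∀ d ∈ (AddMonoid.exponent A).divisors,
        ((∃ i : ℕ, d ∣ p ^ 0 * (p ^ s) ^ i + 1) ↔ IsGood d (p ^ s)) := fun d hd => by
      rw [isGood_iff (Nat.pos_of_mem_divisors hd) (hcop d hd)]
      simp
    refine ⟨fun d hd => ⟨hN d ▸ ordMod_dvd_card hq d, ?_⟩, ?_⟩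
    · by_cases hg : IsGood d (p ^ s)
      · simp [chi, hg]
      · rw [chi, if_neg hg, one_mul, ← hN]
        exact two_mul_ordMod_dvd_card hq hu (mt (hgood d hd).1 hg)
    rw [NEA_eq_selfDualCard, selfDualCard_twist_eq_prod hq hu hpM
      (v := fun x => if ordMod (order hq x) (p ^ s) = 1 then NEA p r s P else
        NHA p r (s * ordMod (order hq x) (p ^ s)) P) (fun z => by simp)]
    · refine (prod_orbits_eq hq hu hD
        (fun d => if ordMod d (p ^ s) = 1 then NEA p r s P else NHA p r (s * ordMod d (p ^ s)) P)
        (fun d => NA p r (s * ordMod d (p ^ s)) P)).trans ?_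
      rw [← Finset.prod_pow_eq_pow_sum, Finset.prod_filter, Finset.prod_filter,
        ← Finset.prod_mul_distrib, ← Finset.prod_mul_distrib]
      refine Finset.prod_congr rfl fun d hd => ?_
      rw [hN, if_congr (hgood d hd) rfl rfl]
      by_cases hg : IsGood d (p ^ s) <;> by_cases hk : ordMod d (p ^ s) = 1 <;> simp [chi, hg, hk]
    · intro x i hi ε hε
      rw [pow_zero, one_mul] at hi
      split_ifs with hk
      · rw [selfDualCard_twist_eq_NEA (e := i), hk, mul_one]
        intro z
        rw [hε, show 0 + s * i = s * ordMod (order hq x) (p ^ s) * i by rw [hk, zero_add, mul_one]]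
      · obtain ⟨h2, e, rfl⟩ := exists_eq_half_ordMod_add (hcop _ (hD x)) hi hk
        refine selfDualCard_twist_eq_NHA (e := e) fun z => ?_
        rw [hε, Nat.mul_div_assoc _ h2, zero_add, mul_add, mul_assoc]
  · intro hs2
    have hss : p ^ (s / 2) * p ^ (s / 2) = p ^ s := by
      rw [← pow_add, ← two_mul, Nat.two_mul_div_two_of_even hs2]
    -- Hermitian case: `c = s / 2` and `a = 1`, with odd exponents `2 * i + 1` of `p ^ (s / 2)`. No
    -- component is Euclidean here, even if `ordMod` is `1`.
    have hu : p ^ (s / 2) * p ^ (s / 2) = (p ^ s) ^ 1 := by rw [hss, pow_one]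
    have hgood : ∀ d, (∃ i : ℕ, d ∣ p ^ (s / 2) * (p ^ s) ^ i + 1) ↔ OddlyGood d (p ^ (s / 2)) :=
      fun d => (oddlyGood_sq_iff hss).symm
    refine ⟨fun d hd => ?_, ?_⟩
    · by_cases hg : OddlyGood d (p ^ (s / 2))
      · simp [lam, hg]
      · rw [lam, if_neg hg, one_mul, ← hN]
        exact two_mul_ordMod_dvd_card hq hu (mt (hgood d).1 hg)
    obtain ⟨σ, hσ⟩ := exists_frobenius (p := p) r s (s / 2)
    rw [NHA_eq_selfDualCard p r s (conjGR_eq_of_residue hσ), selfDualCard_twist_eq_prod hq hu hpM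
      (v := fun x => NHA p r (s * ordMod (order hq x) (p ^ s)) P) hσ]
    · refine (prod_orbits_eq hq hu hD (fun d => NHA p r (s * ordMod d (p ^ s)) P)
        (fun d => NA p r (s * ordMod d (p ^ s)) P)).trans ?_
      rw [← Finset.prod_mul_distrib]
      refine Finset.prod_congr rfl fun d hd => ?_
      rw [hN, if_congr (hgood d) rfl rfl]
      by_cases hg : OddlyGood d (p ^ (s / 2)) <;> simp [lam, hg]
    · intro x i hi ε hε
      obtain ⟨e, he⟩ := exists_eq_ordMod_mul hss hi
      refine selfDualCard_twist_eq_NHA (e := e) fun z => ?_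
      rw [hε, half_add_mul_eq hs2 he]
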